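/- **Setting.** Let $X$ be a real Hausdorff locally convex space with topological dual $X^*$, and let $\gamma$ be a Radon centered Gaussian measure on $X$: a Borel probability measure such that $\gamma(B)=\sup\{\gamma(K): K\subset B \text{ compact}\}$ for every Borel set $B$, and such that every $l\in X^*$ is a centered (possibly degenerate) Gaussian random variable on $(X,\gamma)$. Let $\|\cdot\|_p$ denote the norm of $L^p(\gamma)$. The Cameron--Martin space $H\subset X$ is the set of all $h\in X$ for which the shifted measure $\gamma(\cdot-h)$ is equivalent to $\gamma$, and $$|h|_H=\sup\Bigl\{l(h):\ l\in X^*,\ \int_X l^2\,d\gamma\le 1\Bigr\}.$$ Let $\mathcal{FC}^\infty(X)$ be the set of functions $\varphi(x)=\psi(l_1(x),\dots,l_n(x))$ with $n\ge 0$, $l_i\in X^*$ and $\psi\in C_b^\infty(\mathbb R^n)$ (bounded smooth functions with bounded derivatives of every order). Let $\mathcal{FC}_0^\infty(X,H)$ be the set of vector fields $\Phi(x)=\sum_{i=1}^n\Psi_i(g_1(x),\dots,g_n(x))h_i$ with $n\ge 0$, $\Psi_i\in C_0^\infty(\mathbb R^n)$, $g_i\in X^*$, $h_i\in H$. The divergence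 $\mathrm{div}_\gamma\Phi\in L^1(\gamma)$ is defined by $$\int_X(\mathrm{div}_\gamma\Phi)\,\varphi\,d\gamma=-\int_X\langle\Phi,\nabla\varphi\rangle_H\,d\gamma\qquad\forall\,\varphi\in\mathcal{FC}^\infty(X),$$ where $\langle\Phi(x),\nabla\varphi(x)\rangle_H$ is the derivative $\lim_{s\to0}s^{-1}\bigl(\varphi(x+s\Phi(x))-\varphi(x)\bigr)$ of $\varphi$ at $x$ along $\Phi(x)$. Let $p\in[1,\infty)$, $\alpha\in(0,1]$ and $1/p+1/q=1$. A function $f\in L^p(\gamma)$ belongs to the Gaussian Nikolskii--Besov class $B^\alpha_p(\gamma)$ if there is a number $C\ge0$ such that $$\int_X f\,\mathrm{div}_\gamma\Phi\,d\gamma\le C\,\|\Phi\|_q^{\alpha}\,\|\mathrm{div}_\gamma\Phi\|_q^{1-\alpha}\qquad\text{for all }\Phi\in\mathcal{FC}_0^\infty(X,H)\text{ with }\mathrm{div}_\gamma\Phi\in L^q(\gamma),$$ where $\|\Phi\|_q$ is the $L^q(\gamma)$-norm of $|\Phi|_H$ and $0^0=1$ (the condition $\mathrm{div}_\gamma\Phi\in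 L^q(\gamma)$ is automatic if $p>1$). Let $V_\gamma^{p,\alpha}(f)$ be the infimum of such numbers $C$. For $t\ge 0$ set $$T_tf(x)=\int_X f\bigl(e^{-t}x+\sqrt{1-e^{-2t}}\,y\bigr)\,\gamma(dy),\qquad c_t=\int_0^t\frac{e^{-\tau}}{\sqrt{1-e^{-2\tau}}}\,d\tau,$$ $$C(p)=\Bigl((2\pi)^{-1/2}\int_{\mathbb R}|s|^pe^{-s^2/2}\,ds\Bigr)^{1/p}.$$ **Theorem.** Let $p\in[1,\infty)$, $\alpha\in(0,1]$, $f\in B^\alpha_p(\gamma)$ and $t\ge0$. Then the integral defining $T_tf(x)$ converges absolutely for $\gamma$-a.e. $x$, $T_tf\in L^p(\gamma)$, and $$\|f-T_tf\|_p\le 2^{1-\alpha}\,C(p)^\alpha\,c_t^\alpha\,V_\gamma^{p,\alpha}(f).$$ -/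

import Mathlib

open MeasureTheory ProbabilityTheory
open scoped ENNReal NNReal ContDiff

noncomputable section

namespace GaussBesov

/-- The space `C_b^∞(ℝⁿ)`: bounded infinitely differentiable functions with bounded derivatives of
every order (the order `k = 0` is the boundedness of the function itself). -/
def IsCbInfty {n : ℕ} (ψ : (Fin n → ℝ) → ℝ) : Prop :=
  ContDiff ℝ ∞ ψ ∧ ∀ k : ℕ, ∃ M : ℝ, ∀ x, ‖iteratedFDeriv ℝ k ψ x‖ ≤ M

/-- The space `C_0^∞(ℝⁿ)`: infinitely differentiable functions with compact support. -/
def IsC0Infty {n : ℕ} (ψ : (Fin n → ℝ) → ℝ) : Prop :=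
  ContDiff ℝ ∞ ψ ∧ HasCompactSupport ψ

section LocallyConvex

variable {X : Type*} [AddCommGroup X] [Module ℝ X] [TopologicalSpace X] [MeasurableSpace X]

/-- The smooth cylindrical functions `FC^∞(X)`: functions `x ↦ ψ (l₁ x, …, lₙ x)` with
`ψ ∈ C_b^∞(ℝⁿ)` and `lᵢ ∈ X^*`. -/
def IsCylFun (φ : X → ℝ) : Prop :=
  ∃ (n : ℕ) (ψ : (Fin n → ℝ) → ℝ) (l : Fin n → X →L[ℝ] ℝ),
    IsCbInfty ψ ∧ ∀ x, φ x = ψ (fun i => l i x)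

/-- The Cameron–Martin space `H` of `γ`: the vectors `h` for which the shifted measure
`γ_h(B) = γ(B - h)` is equivalent to `γ`. -/
def cameronMartin (γ : Measure X) : Set X :=
  {h | γ.map (fun x => x + h) ≪ γ ∧ γ ≪ γ.map (fun x => x + h)}

/-- The Cameron–Martin norm `|h|_H = sup {l(h) : l ∈ X^*, ∫ l² dγ ≤ 1}`. -/
def cmNorm (γ : Measure X) (h : X) : ℝ≥0∞ :=
  ⨆ (l : X →L[ℝ] ℝ) (_ : ∫ x, (l x) ^ 2 ∂γ ≤ 1), ENNReal.ofReal (l h)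

/-- The smooth compactly supported cylindrical vector fields `FC_0^∞(X, H)`: fields
`Φ(x) = ∑ᵢ Ψᵢ(g₁ x, …, gₙ x) hᵢ` with `Ψᵢ ∈ C_0^∞(ℝⁿ)`, `gᵢ ∈ X^*` and `hᵢ ∈ H`. -/
def IsCylField (γ : Measure X) (Φ : X → X) : Prop :=
  ∃ (n : ℕ) (Ψ : Fin n → (Fin n → ℝ) → ℝ) (g : Fin n → X →L[ℝ] ℝ) (h : Fin n → X),
    (∀ i, IsC0Infty (Ψ i)) ∧ (∀ i, h i ∈ cameronMartin γ) ∧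
      ∀ x, Φ x = ∑ i, Ψ i (fun j => g j x) • h i

/-- `D` is (a version of) the Gaussian divergence `div_γ Φ`, the adjoint of the gradient along `H`:
`∫ D φ dγ = - ∫ ⟨Φ, ∇φ⟩_H dγ` for all `φ ∈ FC^∞(X)`. The gradient `∇φ(x) ∈ H` is the vector with
`⟨h, ∇φ(x)⟩_H = ∂_h φ(x) = lim_{t → 0} (φ(x + t h) - φ(x)) / t` for `h ∈ H`, so that
`⟨Φ(x), ∇φ(x)⟩_H` is the derivative of `φ` at `x` along the vector `Φ(x)`. -/
def IsGaussDiv (γ : Measure X) (Φ : X → X) (D : X → ℝ) : Prop :=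
  Integrable D γ ∧
    ∀ φ : X → ℝ, IsCylFun φ → ∫ x, D x * φ x ∂γ = -∫ x, lineDeriv ℝ φ x (Φ x) ∂γ

/-- The number `C` is admissible for `f`: `∫ f div_γ Φ dγ ≤ C ‖Φ‖_q^α ‖div_γ Φ‖_q^{1-α}` for all
`Φ ∈ FC_0^∞(X, H)` with `div_γ Φ ∈ L^q(γ)`. The last condition makes both sides meaningful; it
holds for every `Φ` if `q < ∞`, and for `q = ∞` it says that `div_γ Φ` is bounded. Here
`0 ^ 0 = 1`, and `q ∈ (1, ∞]` is the conjugate exponent, `1/p + 1/q = 1`. -/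
def IsBesovBound (γ : Measure X) (p : ℝ≥0∞) (α : ℝ) (f : X → ℝ) (C : ℝ≥0) : Prop :=
  ∀ (Φ : X → X) (D : X → ℝ), IsCylField γ Φ → IsGaussDiv γ Φ D → MemLp D p.conjExponent γ →
    ENNReal.ofReal (∫ x, f x * D x ∂γ) ≤
      C * eLpNorm (fun x => cmNorm γ (Φ x)) p.conjExponent γ ^ α *
        eLpNorm D p.conjExponent γ ^ (1 - α)

/-- The Gaussian Nikolskii–Besov class `B^α_p(γ)`. -/
def MemBesov (γ : Measure X) (p : ℝ≥0∞) (α : ℝ) (f : X → ℝ) : Prop :=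
  MemLp f p γ ∧ ∃ C : ℝ≥0, IsBesovBound γ p α f C

/-- The quantity `V_γ^{p,α}(f)`: the infimum of the admissible numbers `C`, and `∞` if there are
none. -/
def besovV (γ : Measure X) (p : ℝ≥0∞) (α : ℝ) (f : X → ℝ) : ℝ≥0∞ :=
  ⨅ (C : ℝ≥0) (_ : IsBesovBound γ p α f C), (C : ℝ≥0∞)

/-- The Ornstein–Uhlenbeck semigroup
`T_t f(x) = ∫ f(e^{-t} x + (1 - e^{-2t})^{1/2} y) γ(dy)`. -/
def ornsteinUhlenbeck (γ : Measure X) (t : ℝ) (f : X → ℝ) (x : X) : ℝ :=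
  ∫ y, f (Real.exp (-t) • x + √(1 - Real.exp (-2 * t)) • y) ∂γ

end LocallyConvex

/-- `c_t = ∫_0^t e^{-τ} (1 - e^{-2τ})^{-1/2} dτ`. -/
def ouConst (t : ℝ) : ℝ :=
  ∫ τ in (0 : ℝ)..t, Real.exp (-τ) / √(1 - Real.exp (-2 * τ))

/-- `C(p) = ((2π)^{-1/2} ∫ |s|^p e^{-s²/2} ds)^{1/p}`. -/
def gaussMoment (p : ℝ) : ℝ :=
  ((√(2 * Real.pi))⁻¹ * ∫ s : ℝ, |s| ^ p * Real.exp (-s ^ 2 / 2)) ^ (1 / p)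

end GaussBesov

end

set_option linter.unusedSectionVars false

namespace GaussBesov

/-! ### Laws of families of real random variables -/

section Laws

/-! Put θ = c_t. Then cos θ = e^{-t} and sin θ = √(1 - e^{-2t}) (`arccos_exp_neg_eq_ouConst`), so
T_t f(x) is the average of f(cos θ x + sin θ y) over y. The norm of f - T_t f is estimated by
duality with smooth cylindrical functions u (`eLpNorm_le_of_forall_isCylFun`). Since T_t is
symmetric (`integral_mehler_mul`), ∫ (f - T_t f) u dγ = ∫ f (u - T_t u) dγ, and everything rests on
writing u - T_t u as a divergence. For u = ψ ∘ P, with P a finite family of functionals, the field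
is Φ(x) = -θ ∫₀¹ ∫ sin(θσ) ∇u(cos(θσ) x + sin(θσ) y) γ(dy) dσ.

In div Φ, Gaussian integration by parts in y turns second derivatives of ψ into first ones, and the
integrand becomes -d/dσ u(cos(θσ) x + sin(θσ) y); hence div Φ = u - T_t u (`sum_rotGrad_eq`), of L^q
norm at most 2‖u‖_q. Integration by parts also removes the gradient from Φ: for a functional m of
variance at most 1, m(Φ(x)) = -θ ∫∫ u(cos(θσ) x + sin(θσ) y) m(y) γ(dy) dσ. Hölder's inequality and
rotation invariance then give ‖Φ‖_q ≤ θ C(p) ‖u‖_q (`eLpNorm_cmNorm_sum_rotGrad_le`). The Besov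
inequality for Φ yields exactly the asserted constant. The coefficients of Φ need not have compact
support, which cutoffs repair (`IsBesovBound.of_bounded`).

As X need not be separable, the product σ-algebra on X × X may be smaller than the Borel one and (x,
y) ↦ c x + s y need not be measurable for it. Laws are therefore compared on ℝ^{X^*} through
`dualEval`. The Radon property makes integrable functions a.e. equal to measurable functions of the
functionals (`exists_ae_eq_comp_dualEval`), and `ae_measure_mix_eq_zero` shows that T_t does not see
this change. The Radon property also supplies the vectors of H that represent the covariance
(`exists_covar_eq_apply`). -/

/-- Two random families of reals have the same law as soon as all their finite linear combinations
have the same characteristic function at `1`. -/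
theorem map_eq_map_of_charFun {ι Ω Ω' : Type*} [MeasurableSpace Ω] [MeasurableSpace Ω']
    {μ : Measure Ω} {ν : Measure Ω'} [IsFiniteMeasure μ] [IsFiniteMeasure ν]
    {ξ : Ω → ι → ℝ} {η : Ω' → ι → ℝ} (hξ : Measurable ξ) (hη : Measurable η)
    (h : ∀ (s : Finset ι) (a : ι → ℝ),
      ∫ w, Complex.exp ((∑ i ∈ s, a i * ξ w i : ℝ) * Complex.I) ∂μ =
        ∫ w, Complex.exp ((∑ i ∈ s, a i * η w i : ℝ) * Complex.I) ∂ν) :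
    μ.map ξ = ν.map η := by
  classical
  -- A finite measure on ℝ^ι is determined by its finite-dimensional marginals, and each marginal by
  -- its characteristic function.
  have key : ∀ s : Finset ι, (ν.map η).map s.restrict = (μ.map ξ).map s.restrict := by
    intro s
    have hm : Measurable (s.restrict : (ι → ℝ) → (s → ℝ)) := Finset.measurable_restrict s
    refine Measure.ext_of_charFunDual ?_
    ext L
    let a : ι → ℝ := fun i => if hi : i ∈ s then L (Pi.single ⟨i, hi⟩ 1) else 0
    have hL : ∀ z : ι → ℝ, L (s.restrict z) = ∑ i ∈ s, a i * z i := by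
      intro z
      have : s.restrict z = ∑ i : s, z i • (Pi.single i (1 : ℝ) : s → ℝ) := by
        ext j
        simp [Finset.sum_apply, Pi.single_apply]
      rw [this, map_sum, ← Finset.sum_coe_sort s]
      refine Finset.sum_congr rfl fun i _ => ?_
      simp [a, mul_comm]
    have hc : Continuous fun x : s → ℝ => Complex.exp (L x * Complex.I) := by fun_prop
    rw [charFunDual_apply, charFunDual_apply, Measure.map_map hm hη, Measure.map_map hm hξ,
      integral_map (hm.comp hη).aemeasurable hc.aestronglyMeasurable,
      integral_map (hm.comp hξ).aemeasurable hc.aestronglyMeasurable]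
    simp only [Function.comp_apply, hL]
    exact (h s a).symm
  exact IsProjectiveLimit.unique (P := fun s => (μ.map ξ).map s.restrict) (fun _ => rfl) key

end Laws

/-- Compact subsets of B that exhaust it in μ leave a μ-null remainder, which is also ν-null. Their
finite unions are compact and increase to full ν-measure in B. -/
lemma innerRegular_of_absolutelyContinuous {X : Type*} [TopologicalSpace X] [T2Space X]
    [MeasurableSpace X] [BorelSpace X] {μ ν : Measure X} [IsFiniteMeasure μ]
    [IsFiniteMeasure ν] [μ.InnerRegular] (h : ν ≪ μ) : ν.InnerRegular := by
  refine ⟨fun B hB r hr => ?_⟩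
  have hseq : ∀ n : ℕ, ∃ K ⊆ B, IsCompact K ∧ μ B < μ K + ((n : ℝ≥0∞) + 1)⁻¹ := fun n =>
    hB.exists_isCompact_lt_add (measure_ne_top _ _) (by simp)
  choose K hKB hK hlt using hseq
  have h0 : μ (B \ ⋃ n, K n) = 0 := by
    refine le_antisymm (ENNReal.le_of_forall_pos_le_add fun ε hε _ => ?_) bot_le
    obtain ⟨n, hn⟩ := ENNReal.exists_inv_nat_lt (show (ε : ℝ≥0∞) ≠ 0 by exact_mod_cast hε.ne')
    calc μ (B \ ⋃ n, K n) ≤ μ (B \ K n) :=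
          measure_mono (Set.sdiff_subset_sdiff_right (Set.subset_iUnion K n))
      _ ≤ ((n : ℝ≥0∞) + 1)⁻¹ := by
          rw [measure_sdiff (hKB n) (hK n).measurableSet.nullMeasurableSet (measure_ne_top _ _)]
          exact tsub_le_iff_left.2 (hlt n).le
      _ ≤ (n : ℝ≥0∞)⁻¹ := ENNReal.inv_le_inv.2 le_self_add
      _ ≤ 0 + ε := by simpa using hn.le
  have hν : ν B = ν (⋃ n, Set.accumulate K n) := by
    rw [Set.iUnion_accumulate]
    refine le_antisymm ?_ (measure_mono (Set.iUnion_subset hKB))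
    calc ν B ≤ ν ((⋃ n, K n) ∪ (B \ ⋃ n, K n)) := measure_mono fun x hx => by
          by_cases hxK : x ∈ ⋃ n, K n
          · exact Or.inl hxK
          · exact Or.inr ⟨hx, hxK⟩
      _ ≤ ν (⋃ n, K n) + ν (B \ ⋃ n, K n) := measure_union_le _ _
      _ = ν (⋃ n, K n) := by rw [h h0, add_zero]
  rw [hν, Set.monotone_accumulate.measure_iUnion, lt_iSup_iff] at hr
  obtain ⟨n, hn⟩ := hr
  refine ⟨_, ?_, ?_, hn⟩
  · exact Set.iUnion₂_subset fun i _ => hKB i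
  · exact (Set.finite_Iic n).isCompact_biUnion fun i _ => hK i

/-! ### Radon measures are determined by the continuous functionals -/

section Topological

variable {X : Type*} [AddCommGroup X] [Module ℝ X] [TopologicalSpace X]

/-- Evaluation of all continuous linear functionals at a point. -/
def dualEval (x : X) : (X →L[ℝ] ℝ) → ℝ := fun l => l x

lemma measurable_dualEval [MeasurableSpace X] [BorelSpace X] :
    Measurable (dualEval : X → (X →L[ℝ] ℝ) → ℝ) :=
  measurable_pi_iff.2 fun l => l.continuous.measurable

/-- Evaluation of finitely many functionals at a point. -/
def finEval (s : Finset (X →L[ℝ] ℝ)) (x : X) : s → ℝ := fun l => l.1 x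

lemma continuous_finEval (s : Finset (X →L[ℝ] ℝ)) : Continuous (finEval s) :=
  continuous_pi fun l => l.1.continuous

/-- Disjoint compact sets have disjoint images under some finite family of functionals. -/
theorem exists_finEval_disjoint [IsTopologicalAddGroup X] [ContinuousSMul ℝ X]
    [LocallyConvexSpace ℝ X] [T2Space X] {K K' : Set X} (hK : IsCompact K) (hK' : IsCompact K')
    (hd : Disjoint K K') :
    ∃ s : Finset (X →L[ℝ] ℝ), Disjoint (finEval s '' K) (finEval s '' K') := by
  classical
  -- Functionals separate points, so the open sets {l(x) ≠ l(y)} cover the compact set K × K'; a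
  -- finite subcover is the required family.
  obtain ⟨s, hs⟩ := (hK.prod hK').elim_finite_subcover
    (fun l : X →L[ℝ] ℝ => {z : X × X | l z.1 ≠ l z.2})
    (fun l => isOpen_ne_fun (l.continuous.comp continuous_fst) (l.continuous.comp continuous_snd))
    (by
      rintro ⟨x, y⟩ ⟨hx, hy⟩
      have hne : x ≠ y := fun h => Set.disjoint_left.1 hd hx (h ▸ hy)
      obtain ⟨l, hl⟩ := SeparatingDual.exists_separating_of_ne (R := ℝ) hne
      exact Set.mem_iUnion.2 ⟨l, hl⟩)
  refine ⟨s, Set.disjoint_left.2 ?_⟩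
  rintro _ ⟨x, hx, rfl⟩ ⟨y, hy, hxy⟩
  obtain ⟨l, hl, hne⟩ := Set.mem_iUnion₂.1 (hs (Set.mk_mem_prod hx hy))
  exact hne (congrFun hxy ⟨l, hl⟩).symm

/-- Linear combinations of functionals are again functionals, so a single functional at a time
suffices. -/
lemma map_dualEval_eq_of_charFun {Ω Ω' : Type*} [MeasurableSpace Ω] [MeasurableSpace Ω']
    {μ : Measure Ω} {ν : Measure Ω'} [IsFiniteMeasure μ] [IsFiniteMeasure ν]
    {ξ : Ω → (X →L[ℝ] ℝ) → ℝ} {η : Ω' → (X →L[ℝ] ℝ) → ℝ}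
    (hξ : Measurable ξ) (hη : Measurable η) {ξ' : Ω → X} {η' : Ω' → X}
    (hξ' : ∀ w l, ξ w l = l (ξ' w)) (hη' : ∀ w l, η w l = l (η' w))
    (h : ∀ l : X →L[ℝ] ℝ, ∫ w, Complex.exp ((l (ξ' w) : ℝ) * Complex.I) ∂μ =
        ∫ w, Complex.exp ((l (η' w) : ℝ) * Complex.I) ∂ν) :
    μ.map ξ = ν.map η := by
  refine map_eq_map_of_charFun hξ hη fun s a => ?_
  have := h (∑ l ∈ s, a l • l)
  simpa [hξ', hη', sum_apply] using this

variable [MeasurableSpace X] [BorelSpace X]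
variable [IsTopologicalAddGroup X] [ContinuousSMul ℝ X] [LocallyConvexSpace ℝ X] [T2Space X]

/-- A compact set need not be cylindrical. It lies, however, in a cylinder that avoids a compact K'
filling almost all of its complement for ν; μ and ν agree on that cylinder. -/
lemma measure_compact_le_of_map_dualEval {μ ν : Measure X} [IsFiniteMeasure ν] [ν.InnerRegular]
    (h : μ.map dualEval = ν.map dualEval) {K : Set X} (hK : IsCompact K) : μ K ≤ ν K := by
  refine ENNReal.le_of_forall_pos_le_add fun ε hε _ => ?_
  obtain ⟨K', hK's, hK', hlt⟩ := hK.measurableSet.compl.exists_isCompact_lt_add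
    (measure_ne_top ν _) (ε := ε) (by exact_mod_cast hε.ne')
  obtain ⟨s, hs⟩ := exists_finEval_disjoint hK hK' (Set.disjoint_left.2 fun x hx hx' => hK's hx' hx)
  set A := finEval s '' K
  have hA : MeasurableSet A := (hK.image (continuous_finEval s)).measurableSet
  have hpre : MeasurableSet (s.restrict ⁻¹' A : Set ((X →L[ℝ] ℝ) → ℝ)) :=
    Finset.measurable_restrict s hA
  have e : ∀ ρ : Measure X, ρ.map dualEval (s.restrict ⁻¹' A) = ρ (finEval s ⁻¹' A) :=
    fun ρ => Measure.map_apply measurable_dualEval hpre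
  calc μ K ≤ μ (finEval s ⁻¹' A) := measure_mono (Set.subset_preimage_image _ _)
    _ = ν (finEval s ⁻¹' A) := by rw [← e, h, e]
    _ ≤ ν (K'ᶜ) := measure_mono fun x hx hx' =>
        Set.disjoint_left.1 hs hx (Set.mem_image_of_mem _ hx')
    _ ≤ ν (K ∪ (Kᶜ \ K')) := measure_mono fun x hx => by
        by_cases hxK : x ∈ K
        · exact Or.inl hxK
        · exact Or.inr ⟨hxK, hx⟩
    _ ≤ ν K + ν (Kᶜ \ K') := measure_union_le _ _
    _ ≤ ν K + ε := by
        gcongr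
        rw [measure_sdiff hK's hK'.measurableSet.nullMeasurableSet (measure_ne_top _ _)]
        exact tsub_le_iff_left.2 hlt.le

/-- Radon measures are determined by the laws of the continuous linear functionals. -/
theorem ext_of_map_dualEval {μ ν : Measure X} [IsFiniteMeasure μ] [IsFiniteMeasure ν]
    [μ.InnerRegular] [ν.InnerRegular] (h : μ.map dualEval = ν.map dualEval) : μ = ν := by
  ext B hB
  exact Measure.InnerRegularWRT.eq_of_innerRegularWRT_of_forall_eq
    Measure.InnerRegular.innerRegular Measure.InnerRegular.innerRegular
    (fun K hK => le_antisymm (measure_compact_le_of_map_dualEval h hK)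
      (measure_compact_le_of_map_dualEval h.symm hK)) hB

end Topological

/-! ### Covariance and characteristic functionals of a centered Gaussian measure -/

section Gaussian

variable {X : Type*} [AddCommGroup X] [Module ℝ X] [TopologicalSpace X]
  [MeasurableSpace X] [BorelSpace X]

/-- The covariance form of a centered measure. -/
noncomputable def covar (γ : Measure X) (l l' : X →L[ℝ] ℝ) : ℝ := ∫ x, l x * l' x ∂γ

lemma covar_comm (γ : Measure X) (l l' : X →L[ℝ] ℝ) : covar γ l l' = covar γ l' l := by
  simp only [covar, mul_comm]

lemma covar_self_eq (γ : Measure X) (l : X →L[ℝ] ℝ) : covar γ l l = ∫ x, l x ^ 2 ∂γ := by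
  simp only [covar, pow_two]

lemma covar_self_nonneg (γ : Measure X) (l : X →L[ℝ] ℝ) : 0 ≤ covar γ l l :=
  integral_nonneg fun x => mul_self_nonneg (l x)

variable {γ : Measure X} [IsGaussian γ]

lemma memLp_functional (l : X →L[ℝ] ℝ) {p : ℝ≥0∞} (hp : p ≠ ⊤) : MemLp l p γ := by
  suffices MemLp (id ∘ l) p γ from this
  have hl : Measurable l := l.continuous.measurable
  rw [← memLp_map_measure_iff (by fun_prop) hl.aemeasurable, IsGaussian.map_eq_gaussianReal l]
  exact memLp_id_gaussianReal' p hp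

lemma integrable_functional (l : X →L[ℝ] ℝ) : Integrable l γ :=
  memLp_one_iff_integrable.1 (memLp_functional l (by simp))

lemma integrable_functional_mul (l l' : X →L[ℝ] ℝ) : Integrable (fun x => l x * l' x) γ :=
  (memLp_functional l (p := 2) (by simp)).integrable_mul (memLp_functional l' (p := 2) (by simp))

lemma covar_add_right (l m m' : X →L[ℝ] ℝ) : covar γ l (m + m') = covar γ l m + covar γ l m' := by
  simp only [covar, add_apply, mul_add]
  exact integral_add (integrable_functional_mul _ _) (integrable_functional_mul _ _)

lemma covar_smul_right (l m : X →L[ℝ] ℝ) (c : ℝ) : covar γ l (c • m) = c * covar γ l m := by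
  simp only [covar, FunLike.coe_smul, Pi.smul_apply, smul_eq_mul, ← integral_const_mul]
  congr 1 with x
  ring

lemma covar_add_left (l m m' : X →L[ℝ] ℝ) : covar γ (m + m') l = covar γ m l + covar γ m' l := by
  rw [covar_comm, covar_add_right, covar_comm γ m, covar_comm γ m']

lemma covar_smul_left (l m : X →L[ℝ] ℝ) (c : ℝ) : covar γ (c • m) l = c * covar γ m l := by
  rw [covar_comm, covar_smul_right, covar_comm γ m]

lemma covar_eq_zero_of_self (l m : X →L[ℝ] ℝ) (h : covar γ l l = 0) : covar γ l m = 0 := by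
  have h0 : (fun x => l x * l x) =ᵐ[γ] 0 :=
    (integral_eq_zero_iff_of_nonneg (fun x => mul_self_nonneg (l x))
      (integrable_functional_mul l l)).1 h
  rw [covar, ← integral_zero X ℝ (μ := γ)]
  refine integral_congr_ae ?_
  filter_upwards [h0] with x hx
  simp [mul_self_eq_zero.1 hx]

variable (hc : ∀ l : X →L[ℝ] ℝ, ∫ x, l x ∂γ = 0)
include hc

lemma map_functional (l : X →L[ℝ] ℝ) : γ.map l = gaussianReal 0 (covar γ l l).toNNReal := by
  have hl : Measurable l := l.continuous.measurable
  rw [IsGaussian.map_eq_gaussianReal l, hc l, variance_of_integral_eq_zero hl.aemeasurable (hc l),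
    covar_self_eq]

lemma integral_cexp_functional (l : X →L[ℝ] ℝ) (z : ℂ) :
    ∫ x, Complex.exp (z * l x) ∂γ = Complex.exp (covar γ l l * z ^ 2 / 2) := by
  have := complexMGF_gaussianReal (map_functional hc l) z
  rw [complexMGF] at this
  rw [this]
  congr 1
  have h : ((covar γ l l).toNNReal : ℝ) = covar γ l l :=
    Real.coe_toNNReal _ (covar_self_nonneg γ l)
  rw [h]
  simp

lemma integral_cexp_functional_mul_I (l : X →L[ℝ] ℝ) :
    ∫ x, Complex.exp ((l x : ℝ) * Complex.I) ∂γ = Complex.exp (-(covar γ l l : ℂ) / 2) := by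
  have := integral_cexp_functional hc l Complex.I
  simp only [mul_comm Complex.I] at this
  rw [this]
  simp [neg_div]

lemma integrable_exp_functional (l : X →L[ℝ] ℝ) : Integrable (fun x => Real.exp (l x)) γ := by
  have hl : Measurable l := l.continuous.measurable
  have h := integrable_exp_mul_gaussianReal (μ := 0) (v := (covar γ l l).toNNReal) 1
  rw [← map_functional hc l] at h
  simpa [Function.comp_def] using (integrable_map_measure (by fun_prop) hl.aemeasurable).1 h

lemma indepFun_of_covar_eq_zero (l m : X →L[ℝ] ℝ) (h : covar γ l m = 0) : IndepFun l m γ := by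
  have hid : HasGaussianLaw (id : X → X) γ := IsGaussian.hasGaussianLaw_id
  have hl : Measurable l := l.continuous.measurable
  have hm : Measurable m := m.continuous.measurable
  have hg : HasGaussianLaw (fun x => (l x, m x)) γ :=
    hid.map_of_measurable (l.prod m) (hl.prodMk hm)
  refine hg.indepFun_of_covariance_eq_zero ?_
  rw [covariance_eq_sub (memLp_functional l (by simp)) (memLp_functional m (by simp)), hc l]
  simpa [covar] using h

/-- The characteristic functional of the measure `exp(l) γ`. -/
lemma integral_cexp_mul_exp (l l' : X →L[ℝ] ℝ) :
    ∫ x, Complex.exp ((l' x : ℝ) * Complex.I) * Complex.exp (l x) ∂γ =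
      Complex.exp (covar γ l l' * Complex.I + (covar γ l l - covar γ l' l') / 2) := by
  set σ := covar γ l l with hσ
  -- The regression coefficient of l' on l: the remainder m = l' - a l is uncorrelated with l, hence
  -- independent of it, and the integral factorizes. If σ = 0, then a = 0 by the convention for
  -- division, and covar γ l l' vanishes too.
  set a : ℝ := covar γ l l' / σ with ha
  set m : X →L[ℝ] ℝ := l' + (-a) • l with hm
  have haσ : a * σ = covar γ l l' := by
    by_cases h0 : σ = 0
    · rw [covar_eq_zero_of_self l l' h0, h0, mul_zero]
    · exact div_mul_cancel₀ _ h0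
  have hlm : covar γ l m = 0 := by
    rw [hm, covar_add_right, covar_smul_right, ← haσ]; ring
  have hmm : covar γ m m = covar γ l' l' - a ^ 2 * σ := by
    simp only [hm, covar_add_right, covar_smul_right, covar_add_left, covar_smul_left,
      covar_comm γ l' l, ← haσ, ← hσ]
    ring
  have hind := (indepFun_of_covar_eq_zero hc l m hlm).comp
    (φ := fun r : ℝ => Complex.exp ((1 + a * Complex.I) * r))
    (ψ := fun r : ℝ => Complex.exp (r * Complex.I)) (by fun_prop) (by fun_prop)
  have hl : Measurable l := l.continuous.measurable
  have hmM : Measurable m := m.continuous.measurable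
  have e : ∀ x, Complex.exp ((l' x : ℝ) * Complex.I) * Complex.exp (l x) =
      Complex.exp ((1 + a * Complex.I) * l x) * Complex.exp ((m x : ℝ) * Complex.I) := by
    intro x
    rw [← Complex.exp_add, ← Complex.exp_add]
    congr 1
    simp only [hm, add_apply, FunLike.coe_smul, Pi.smul_apply, smul_eq_mul]
    push_cast
    ring
  simp_rw [e]
  have hprod := hind.integral_fun_mul_eq_mul_integral
    (Measurable.aestronglyMeasurable (by fun_prop)) (Measurable.aestronglyMeasurable (by fun_prop))
  simp only [Function.comp_apply] at hprod
  rw [hprod, integral_cexp_functional hc, integral_cexp_functional_mul_I hc, hmm, ← Complex.exp_add,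
    ← haσ]
  congr 1
  push_cast
  linear_combination (-(a : ℂ) ^ 2 * σ / 2 + (a : ℂ) ^ 2 * σ) * Complex.I_sq

end Gaussian

/-! ### Exponential tilts, the Cameron–Martin formula, integration by parts -/

section CameronMartin

variable {X : Type*} [AddCommGroup X] [Module ℝ X] [TopologicalSpace X]
  [MeasurableSpace X] [BorelSpace X]

/-- The measure `exp(l - σ(l)² / 2) γ`. -/
noncomputable def tilt (γ : Measure X) (l : X →L[ℝ] ℝ) : Measure X :=
  γ.withDensity fun x => ENNReal.ofReal (Real.exp (l x - covar γ l l / 2))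

variable {γ : Measure X} [IsGaussian γ]

lemma integral_tilt {E : Type*} [NormedAddCommGroup E] [NormedSpace ℝ E] (l : X →L[ℝ] ℝ)
    (F : X → E) : ∫ x, F x ∂(tilt γ l) = ∫ x, Real.exp (l x - covar γ l l / 2) • F x ∂γ := by
  have hl : Measurable l := l.continuous.measurable
  rw [tilt, integral_withDensity_eq_integral_toReal_smul (by fun_prop) (by simp)]
  refine integral_congr_ae (.of_forall fun x => ?_)
  simp [ENNReal.toReal_ofReal (Real.exp_pos _).le]

lemma covar_sum_right (l : X →L[ℝ] ℝ) {ι : Type*} (s : Finset ι) (a : ι → ℝ) (m : ι → X →L[ℝ] ℝ) :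
    covar γ l (∑ i ∈ s, a i • m i) = ∑ i ∈ s, a i * covar γ l (m i) := by
  classical
  induction s using Finset.induction_on with
  | empty => simp [covar]
  | insert i s hi ih =>
    rw [Finset.sum_insert hi, Finset.sum_insert hi, covar_add_right, covar_smul_right, ih]

variable (hc : ∀ l : X →L[ℝ] ℝ, ∫ x, l x ∂γ = 0)
include hc

lemma integral_cexp_tilt (l l' : X →L[ℝ] ℝ) :
    ∫ x, Complex.exp ((l' x : ℝ) * Complex.I) ∂(tilt γ l) =
      Complex.exp (covar γ l l' * Complex.I - covar γ l' l' / 2) := by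
  rw [integral_tilt]
  have e : ∀ x, Real.exp (l x - covar γ l l / 2) • Complex.exp ((l' x : ℝ) * Complex.I) =
      Complex.exp (-(covar γ l l : ℂ) / 2) *
        (Complex.exp ((l' x : ℝ) * Complex.I) * Complex.exp (l x)) := by
    intro x
    rw [Complex.real_smul, Complex.ofReal_exp, ← Complex.exp_add, ← Complex.exp_add,
      ← Complex.exp_add]
    congr 1
    push_cast
    ring
  simp_rw [e]
  rw [integral_const_mul, integral_cexp_mul_exp hc, ← Complex.exp_add]
  congr 1
  ring

lemma isProbabilityMeasure_tilt (l : X →L[ℝ] ℝ) : IsProbabilityMeasure (tilt γ l) := by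
  have hfin : IsFiniteMeasure (tilt γ l) := by
    have h := (integrable_exp_functional hc l).const_mul (Real.exp (-(covar γ l l / 2)))
    refine isFiniteMeasure_withDensity_ofReal (Integrable.hasFiniteIntegral (h.congr ?_))
    refine .of_forall fun x => ?_
    simp only [← Real.exp_add]
    congr 1
    ring
  -- The total mass is the characteristic functional at 0.
  have h := integral_cexp_tilt hc l 0
  have h1 : (tilt γ l).real Set.univ = 1 := by
    have : (((tilt γ l).real Set.univ : ℝ) : ℂ) = 1 := by simpa [covar] using h
    exact_mod_cast this
  refine ⟨?_⟩
  rw [← ENNReal.toReal_eq_one_iff]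
  exact h1

/-- The tilt acts on functionals as a deterministic translation m ↦ m + covar γ l m. At this stage
the translation lives in ℝ^{X^*}; no vector of X is known to induce it. -/
lemma map_dualEval_tilt (l : X →L[ℝ] ℝ) :
    (tilt γ l).map dualEval = γ.map fun x (m : X →L[ℝ] ℝ) => m x + covar γ l m := by
  have := isProbabilityMeasure_tilt hc l
  refine map_eq_map_of_charFun measurable_dualEval
    (measurable_pi_iff.2 fun m => m.continuous.measurable.add_const _) fun s a => ?_
  have h1 := integral_cexp_tilt hc l (∑ m ∈ s, a m • m)
  have h2 := integral_cexp_functional_mul_I hc (∑ m ∈ s, a m • m)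
  have e : ∀ x : X, (∑ m ∈ s, a m • m) x = ∑ m ∈ s, a m * m x := fun x => by simp [sum_apply]
  simp only [e] at h1 h2
  simp only [dualEval, h1]
  have e' : ∀ x : X, Complex.exp ((∑ m ∈ s, a m * (m x + covar γ l m) : ℝ) * Complex.I) =
      Complex.exp (covar γ l (∑ m ∈ s, a m • m) * Complex.I) *
        Complex.exp ((∑ m ∈ s, a m * m x : ℝ) * Complex.I) := by
    intro x
    rw [← Complex.exp_add, covar_sum_right, ← add_mul, ← Complex.ofReal_add,
      ← Finset.sum_add_distrib]
    congr 4 with m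
    ring
  simp_rw [e']
  rw [integral_const_mul, h2, ← Complex.exp_add]
  congr 1
  ring

variable [IsTopologicalAddGroup X] [ContinuousSMul ℝ X] [T2Space X] [γ.InnerRegular]

/-- For a Radon Gaussian measure, the covariance operator takes values in the space itself. -/
theorem exists_covar_eq_apply (l : X →L[ℝ] ℝ) : ∃ h : X, ∀ m : X →L[ℝ] ℝ, m h = covar γ l m := by
  have := isProbabilityMeasure_tilt hc l
  have : (tilt γ l).InnerRegular :=
    innerRegular_of_absolutelyContinuous (withDensity_absolutelyContinuous γ _)
  have hhalf : ∀ μ : Measure X, IsProbabilityMeasure μ → μ.InnerRegular →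
      ∃ K, IsCompact K ∧ 2⁻¹ < μ K := fun μ _ _ => by
    obtain ⟨K, -, hK, h⟩ := MeasurableSet.univ.exists_lt_isCompact (μ := μ) (r := 2⁻¹)
      (by rw [measure_univ]; exact ENNReal.inv_lt_one.2 (by norm_num))
    exact ⟨K, hK, h⟩
  -- One compact K carries more than half of both γ and its tilt. The representing vector is sought
  -- in the compact set K - K, so by compactness only finitely many equations m(h) = covar γ l m
  -- need be solved at once.
  obtain ⟨K₁, hK₁, h₁⟩ := hhalf γ inferInstance inferInstance
  obtain ⟨K₂, hK₂, h₂⟩ := hhalf (tilt γ l) inferInstance inferInstance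
  set K := K₁ ∪ K₂
  have hK : IsCompact K := hK₁.union hK₂
  have hD : IsCompact ((fun z : X × X => z.1 - z.2) '' (K ×ˢ K)) :=
    (hK.prod hK).image (continuous_fst.sub continuous_snd)
  obtain ⟨h, -, hh⟩ := hD.inter_iInter_nonempty (fun m : X →L[ℝ] ℝ => {h | m h = covar γ l m})
    (fun m => isClosed_eq m.continuous continuous_const) fun s => by
      set A := finEval s '' K
      have hA : MeasurableSet A := (hK.image (continuous_finEval s)).measurableSet
      have hpre : MeasurableSet (s.restrict ⁻¹' A : Set ((X →L[ℝ] ℝ) → ℝ)) :=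
        Finset.measurable_restrict s hA
      have hmS : Measurable fun x (m : X →L[ℝ] ℝ) => m x + covar γ l m :=
        measurable_pi_iff.2 fun m => m.continuous.measurable.add_const _
      have hlaw := congrArg (fun ρ => ρ (s.restrict ⁻¹' A)) (map_dualEval_tilt hc l)
      simp only [Measure.map_apply measurable_dualEval hpre, Measure.map_apply hmS hpre] at hlaw
      -- Two events of γ-probability above 1/2 must meet: for some x, the values of the functionals
      -- in s at x and their translates are both attained on K, at k and k', and k' - k solves the
      -- equations.
      have hsum : γ Set.univ < γ (finEval s ⁻¹' A) +
          γ ((fun x (m : X →L[ℝ] ℝ) => m x + covar γ l m) ⁻¹' (s.restrict ⁻¹' A)) := by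
        rw [measure_univ, ← hlaw, ← ENNReal.inv_two_add_inv_two]
        refine ENNReal.add_lt_add (h₁.trans_le (measure_mono ?_)) (h₂.trans_le (measure_mono ?_))
        · exact Set.subset_union_left.trans (Set.subset_preimage_image _ _)
        · exact Set.subset_union_right.trans (Set.subset_preimage_image (finEval s) _)
      obtain ⟨x, ⟨k, hk, hkx⟩, ⟨k', hk', hkx'⟩⟩ := nonempty_inter_of_measure_lt_add γ
        (hmS hpre) (Set.subset_univ _) (Set.subset_univ _) hsum
      refine ⟨k' - k, ⟨(k', k), ⟨hk', hk⟩, rfl⟩, Set.mem_iInter₂.2 fun m hm => ?_⟩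
      have e1 : m k = m x := congrFun hkx ⟨m, hm⟩
      have e2 : m k' = m x + covar γ l m := congrFun hkx' ⟨m, hm⟩
      simp [e1, e2]
  exact ⟨h, fun m => Set.mem_iInter.1 hh m⟩

variable [LocallyConvexSpace ℝ X]

/-- The Cameron–Martin formula. -/
theorem map_add_eq_tilt {l : X →L[ℝ] ℝ} {h : X} (hh : ∀ m : X →L[ℝ] ℝ, m h = covar γ l m) :
    γ.map (fun x => x + h) = tilt γ l := by
  have := isProbabilityMeasure_tilt hc l
  have : (tilt γ l).InnerRegular :=
    innerRegular_of_absolutelyContinuous (withDensity_absolutelyContinuous γ _)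
  have hm : Measurable fun x : X => x + h := (continuous_add_const h).measurable
  have : IsProbabilityMeasure (γ.map fun x => x + h) :=
    Measure.isProbabilityMeasure_map hm.aemeasurable
  have : (γ.map fun x => x + h).InnerRegular := innerRegular_map_add_right h
  refine ext_of_map_dualEval ?_
  rw [map_dualEval_tilt hc, Measure.map_map measurable_dualEval hm]
  congr 1
  ext x m
  simp [dualEval, hh]

theorem mem_cameronMartin {l : X →L[ℝ] ℝ} {h : X} (hh : ∀ m : X →L[ℝ] ℝ, m h = covar γ l m) :
    h ∈ cameronMartin γ := by
  have hl : Measurable l := l.continuous.measurable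
  rw [cameronMartin, Set.mem_ofPred_eq, map_add_eq_tilt hc hh]
  exact ⟨withDensity_absolutelyContinuous γ _, withDensity_absolutelyContinuous'
    (Measurable.aemeasurable (by fun_prop)) (.of_forall fun x => by simp [Real.exp_pos])⟩

/-- Gaussian integration by parts along a Cameron–Martin direction. -/
theorem integral_lineDeriv_eq {l : X →L[ℝ] ℝ} {h : X} (hh : ∀ m : X →L[ℝ] ℝ, m h = covar γ l m)
    {φ φ' : X → ℝ} (hφ : Measurable φ) (hφ' : Measurable φ') {B B' : ℝ} (hB : ∀ x, |φ x| ≤ B)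
    (hB' : ∀ x, |φ' x| ≤ B') (hd : ∀ x, HasLineDerivAt ℝ φ (φ' x) x h) :
    ∫ x, φ' x ∂γ = ∫ x, φ x * l x ∂γ := by
  have hl : Measurable l := l.continuous.measurable
  have hadd : ∀ s : ℝ, Measurable fun x : X => x + s • h :=
    fun s => (continuous_add_const (s • h)).measurable
  set σ := covar γ l l
  have hσ : 0 ≤ σ := covar_self_nonneg γ l
  have hB0 : 0 ≤ B := (abs_nonneg _).trans (hB 0)
  have hder : ∀ x (s : ℝ), HasDerivAt (fun s : ℝ => φ (x + s • h)) (φ' (x + s • h)) s := by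
    intro x s
    have h0 : HasDerivAt (fun t : ℝ => φ (x + s • h + t • h)) (φ' (x + s • h)) (s - s) := by
      rw [sub_self]; exact hd (x + s • h)
    have h1 := HasDerivAt.comp_sub_const s s h0
    refine h1.congr_of_eventuallyEq (.of_forall fun t => ?_)
    simp only
    congr 1
    rw [add_assoc, ← add_smul]
    congr 2
    ring
  -- The Cameron–Martin formula for s h, represented by s l. Differentiating both sides at s = 0
  -- gives the integration by parts.
  have key : ∀ s : ℝ, ∫ x, φ (x + s • h) ∂γ = ∫ x, Real.exp (s * l x - s ^ 2 * σ / 2) * φ x ∂γ := by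
    intro s
    have hs : ∀ m : X →L[ℝ] ℝ, m (s • h) = covar γ (s • l) m := fun m => by
      rw [map_smul, hh, covar_smul_left, smul_eq_mul]
    rw [← integral_map (φ := fun x => x + s • h) (hadd s).aemeasurable
      hφ.aestronglyMeasurable, map_add_eq_tilt hc hs, integral_tilt]
    refine integral_congr_ae (.of_forall fun x => ?_)
    simp only [FunLike.coe_smul, Pi.smul_apply, smul_eq_mul, covar_smul_left, covar_smul_right]
    congr 3
    ring
  have hL : HasDerivAt (fun s : ℝ => ∫ x, φ (x + s • h) ∂γ) (∫ x, φ' (x + (0 : ℝ) • h) ∂γ) 0 := by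
    refine (hasDerivAt_integral_of_dominated_loc_of_deriv_le (bound := fun _ => B')
      (s := Set.univ) Filter.univ_mem
      (.of_forall fun s => (hφ.comp (hadd s)).aestronglyMeasurable) ?_
      (hφ'.comp (hadd 0)).aestronglyMeasurable (.of_forall fun x s _ => hB' _)
      (integrable_const _) (.of_forall fun x s _ => hder x s)).2
    exact Integrable.of_bound (hφ.comp (hadd 0)).aestronglyMeasurable B (.of_forall fun x => hB _)
  -- A dominating function for |s| < 1: the s-derivative of the right-hand integrand is at most B (1
  -- + σ) e^{2|l|}, and e^{2|l|} ≤ e^{2l} + e^{-2l}.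
  have hexp : Integrable (fun x => B * (1 + σ) * (Real.exp (2 * l x) + Real.exp (-2 * l x))) γ := by
    have h1 := integrable_exp_functional hc ((2 : ℝ) • l)
    have h2 := integrable_exp_functional hc ((-2 : ℝ) • l)
    exact (h1.add h2).const_mul _
  have hR : HasDerivAt (fun s : ℝ => ∫ x, Real.exp (s * l x - s ^ 2 * σ / 2) * φ x ∂γ)
      (∫ x, Real.exp (0 * l x - 0 ^ 2 * σ / 2) * (l x - 0 * σ) * φ x ∂γ) 0 := by
    refine (hasDerivAt_integral_of_dominated_loc_of_deriv_le
      (F' := fun s x => Real.exp (s * l x - s ^ 2 * σ / 2) * (l x - s * σ) * φ x)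
      (s := Metric.ball 0 1) (Metric.ball_mem_nhds 0 one_pos)
      (.of_forall fun s => Measurable.aestronglyMeasurable (by fun_prop)) ?_
      (Measurable.aestronglyMeasurable (by fun_prop)) (.of_forall fun x s hs => ?_) hexp
      (.of_forall fun x s _ => ?_)).2
    · simpa using Integrable.of_bound (hφ.aestronglyMeasurable (μ := γ)) B (.of_forall fun x => hB x)
    · have hs1 : |s| ≤ 1 := by simpa using (Metric.mem_ball.1 hs).le
      have e1 : Real.exp (s * l x - s ^ 2 * σ / 2) ≤ Real.exp |l x| := by
        refine Real.exp_le_exp.2 ?_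
        have : s * l x ≤ |l x| := by
          calc s * l x ≤ |s * l x| := le_abs_self _
            _ = |s| * |l x| := abs_mul _ _
            _ ≤ 1 * |l x| := by gcongr
            _ = |l x| := one_mul _
        have : 0 ≤ s ^ 2 * σ / 2 := by positivity
        linarith
      have e2 : |l x - s * σ| ≤ (1 + σ) * Real.exp |l x| := by
        have h1 : |l x| ≤ Real.exp |l x| := by linarith [Real.add_one_le_exp |l x|]
        have h2 : 1 ≤ Real.exp |l x| := Real.one_le_exp (abs_nonneg _)
        calc |l x - s * σ| ≤ |l x| + |s * σ| := abs_sub _ _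
          _ = |l x| + |s| * σ := by rw [abs_mul, abs_of_nonneg hσ]
          _ ≤ Real.exp |l x| + 1 * σ := by gcongr
          _ ≤ Real.exp |l x| + Real.exp |l x| * σ := by gcongr
          _ = _ := by ring
      have e3 : Real.exp |l x| * Real.exp |l x| ≤ Real.exp (2 * l x) + Real.exp (-2 * l x) := by
        rw [← Real.exp_add]
        rcases abs_cases (l x) with ⟨h, -⟩ | ⟨h, -⟩ <;> rw [h]
        · rw [← two_mul]; linarith [Real.exp_pos (-2 * l x)]
        · rw [show -l x + -l x = -2 * l x by ring]; linarith [Real.exp_pos (2 * l x)]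
      rw [Real.norm_eq_abs, abs_mul, abs_mul, abs_of_pos (Real.exp_pos _)]
      calc Real.exp (s * l x - s ^ 2 * σ / 2) * |l x - s * σ| * |φ x|
          ≤ Real.exp |l x| * ((1 + σ) * Real.exp |l x|) * B := by
            gcongr
            exact hB x
        _ = B * (1 + σ) * (Real.exp |l x| * Real.exp |l x|) := by ring
        _ ≤ _ := by gcongr
    · have h1 : HasDerivAt (fun s : ℝ => s * l x - s ^ 2 * σ / 2) (l x - s * σ) s := by
        have := ((hasDerivAt_id s).mul_const (l x)).sub
          ((((hasDerivAt_id s).pow 2).mul_const σ).div_const 2)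
        refine this.congr_deriv ?_
        simp
        ring
      exact (h1.exp).mul_const _
  have hEq : (fun s : ℝ => ∫ x, φ (x + s • h) ∂γ) =
      fun s : ℝ => ∫ x, Real.exp (s * l x - s ^ 2 * σ / 2) * φ x ∂γ := funext key
  rw [hEq] at hL
  have := hL.unique hR
  simp only [zero_smul, add_zero] at this
  rw [this]
  refine integral_congr_ae (.of_forall fun x => ?_)
  simp [mul_comm]

end CameronMartin

/-! ### Bounded smooth functions and smooth separation in ℝⁿ -/

section CbInfty

lemma IsCbInfty.add {n : ℕ} {ψ ψ' : (Fin n → ℝ) → ℝ} (h : IsCbInfty ψ) (h' : IsCbInfty ψ') :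
    IsCbInfty (ψ + ψ') := by
  refine ⟨h.1.add h'.1, fun k => ?_⟩
  obtain ⟨M, hM⟩ := h.2 k
  obtain ⟨M', hM'⟩ := h'.2 k
  refine ⟨M + M', fun x => ?_⟩
  rw [iteratedFDeriv_add_apply (h.1.contDiffAt.of_le (by exact_mod_cast le_top))
    (h'.1.contDiffAt.of_le (by exact_mod_cast le_top))]
  exact norm_add_le_of_le (hM x) (hM' x)

lemma IsCbInfty.const_mul {n : ℕ} {ψ : (Fin n → ℝ) → ℝ} (h : IsCbInfty ψ) (c : ℝ) :
    IsCbInfty (fun x => c * ψ x) := by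
  refine ⟨contDiff_const.mul h.1, fun k => ?_⟩
  obtain ⟨M, hM⟩ := h.2 k
  refine ⟨|c| * M, fun x => ?_⟩
  have := iteratedFDeriv_const_smul_apply' (a := c) (i := k)
    (h.1.contDiffAt.of_le (by exact_mod_cast le_top) (x := x))
  simp only [smul_eq_mul] at this
  rw [this, norm_smul, Real.norm_eq_abs]
  gcongr
  exact hM x

lemma IsCbInfty.comp_clm {m n : ℕ} {ψ : (Fin n → ℝ) → ℝ} (h : IsCbInfty ψ)
    (L : (Fin m → ℝ) →L[ℝ] (Fin n → ℝ)) : IsCbInfty (ψ ∘ L) := by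
  refine ⟨h.1.comp L.contDiff, fun k => ?_⟩
  obtain ⟨M, hM⟩ := h.2 k
  refine ⟨M * ∏ _i : Fin k, ‖L‖, fun x => ?_⟩
  rw [L.iteratedFDeriv_comp_right h.1 x (by exact_mod_cast le_top)]
  refine (ContinuousMultilinearMap.norm_compContinuousLinearMap_le _ _).trans ?_
  gcongr
  exact hM _

/-- Composition with the sine serves as a smooth truncation that stays inside the class. -/
lemma IsCbInfty.sin {n : ℕ} {ψ : (Fin n → ℝ) → ℝ} (h : IsCbInfty ψ) :
    IsCbInfty (fun x => Real.sin (ψ x)) := by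
  refine ⟨Real.contDiff_sin.comp h.1, fun k => ?_⟩
  choose M hM using h.2
  -- The summand 1 ensures D ≥ 1, so D ≤ D ^ i for i ≥ 1, the form in which the bound on derivatives
  -- of a composition takes its hypothesis.
  set D : ℝ := 1 + ∑ i ∈ Finset.range (k + 1), |M i|
  have hD1 : 1 ≤ D := le_add_of_nonneg_right (Finset.sum_nonneg fun i _ => abs_nonneg _)
  refine ⟨k.factorial * 1 * D ^ k, fun x => ?_⟩
  refine norm_iteratedFDeriv_comp_le (N := ∞) (g := Real.sin) Real.contDiff_sin h.1
    (by exact_mod_cast le_top) x (fun i _ => ?_) (fun i hi hik => ?_)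
  · rw [norm_iteratedFDeriv_eq_norm_iteratedDeriv]
    exact Real.abs_iteratedDeriv_sin_le_one i _
  · calc ‖iteratedFDeriv ℝ i ψ x‖ ≤ |M i| := (hM i x).trans (le_abs_self _)
      _ ≤ ∑ i ∈ Finset.range (k + 1), |M i| :=
        Finset.single_le_sum (f := fun i => |M i|) (fun i _ => abs_nonneg _)
          (Finset.mem_range.2 (by omega))
      _ ≤ D := le_add_of_nonneg_left zero_le_one
      _ ≤ D ^ i := le_self_pow₀ hD1 (by omega)

lemma IsC0Infty.isCbInfty {n : ℕ} {ψ : (Fin n → ℝ) → ℝ} (h : IsC0Infty ψ) : IsCbInfty ψ := by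
  refine ⟨h.1, fun k => ?_⟩
  have hc : Continuous (iteratedFDeriv ℝ k ψ) :=
    h.1.continuous_iteratedFDeriv (by exact_mod_cast le_top)
  obtain ⟨C, hC⟩ := (h.2.iteratedFDeriv k).exists_bound_of_continuous hc
  exact ⟨C, hC⟩

/-- Smooth compactly supported separation of two disjoint compact sets. -/
lemma exists_isC0Infty_zero_one {n : ℕ} {A A' : Set (Fin n → ℝ)} (hA : IsCompact A)
    (hA' : IsCompact A') (hd : Disjoint A A') :
    ∃ χ : (Fin n → ℝ) → ℝ, IsC0Infty χ ∧ Set.EqOn χ 1 A ∧ Set.EqOn χ 0 A' ∧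
      ∀ x, χ x ∈ Set.Icc (0 : ℝ) 1 := by
  -- Requiring the function to vanish outside a ball around A as well as on A' makes its support
  -- compact.
  obtain ⟨R, hR⟩ := hA.isBounded.subset_ball 0
  obtain ⟨f, hf0, hf1, hf⟩ := exists_contMDiffMap_zero_one_of_isClosed
    (modelWithCornersSelf ℝ (Fin n → ℝ)) (n := ⊤)
    (hA'.isClosed.union (Metric.isOpen_ball (x := (0 : Fin n → ℝ)) (ε := R)).isClosed_compl)
    hA.isClosed (Set.disjoint_union_left.2 ⟨hd.symm, Set.disjoint_compl_left_iff_subset.2 hR⟩)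
  refine ⟨f, ⟨f.contMDiff.contDiff, ?_⟩, hf1, fun x hx => hf0 (Or.inl hx), hf⟩
  refine HasCompactSupport.intro (isCompact_closedBall (0 : Fin n → ℝ) R) fun x hx => ?_
  exact hf0 (Or.inr fun hx' => hx (Metric.ball_subset_closedBall hx'))

end CbInfty

/-! ### Cylindrical functions and their density -/

section Cylinder

variable {X : Type*} [AddCommGroup X] [Module ℝ X] [TopologicalSpace X]

lemma IsCylFun.add {u v : X → ℝ} (hu : IsCylFun u) (hv : IsCylFun v) : IsCylFun (u + v) := by
  obtain ⟨n, ψ, l, hψ, hu⟩ := hu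
  obtain ⟨m, ψ', l', hψ', hv⟩ := hv
  let L : (Fin (n + m) → ℝ) →L[ℝ] (Fin n → ℝ) :=
    ContinuousLinearMap.pi fun i => ContinuousLinearMap.proj (Fin.castAdd m i)
  let L' : (Fin (n + m) → ℝ) →L[ℝ] (Fin m → ℝ) :=
    ContinuousLinearMap.pi fun i => ContinuousLinearMap.proj (Fin.natAdd n i)
  refine ⟨n + m, ψ ∘ L + ψ' ∘ L', Fin.append l l', (hψ.comp_clm L).add (hψ'.comp_clm L'),
    fun x => ?_⟩
  simp only [Pi.add_apply, Function.comp_apply, hu, hv]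
  congr 2 <;> ext i <;> simp [L, L']

lemma IsCylFun.const_mul_sin {u : X → ℝ} (hu : IsCylFun u) (c : ℝ) :
    IsCylFun fun x => c * Real.sin (u x) := by
  obtain ⟨n, ψ, l, hψ, hu⟩ := hu
  exact ⟨n, _, l, hψ.sin.const_mul c, fun x => by simp only [hu]⟩

lemma IsCylFun.continuous {u : X → ℝ} (hu : IsCylFun u) : Continuous u := by
  obtain ⟨n, ψ, l, hψ, hu⟩ := hu
  rw [show u = fun x => ψ fun i => l i x from funext hu]
  exact hψ.1.continuous.comp (continuous_pi fun i => (l i).continuous)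

lemma IsCylFun.bounded {u : X → ℝ} (hu : IsCylFun u) : ∃ M, ∀ x, |u x| ≤ M := by
  obtain ⟨n, ψ, l, hψ, hu⟩ := hu
  obtain ⟨M, hM⟩ := hψ.2 0
  refine ⟨M, fun x => ?_⟩
  have := hM fun i => l i x
  rwa [norm_iteratedFDeriv_zero, Real.norm_eq_abs, ← hu] at this

/-- Factoring through ℝ^{X^*} makes identities between laws of functionals applicable to u. -/
lemma IsCylFun.eq_comp_dualEval {u : X → ℝ} (hu : IsCylFun u) :
    ∃ w : ((X →L[ℝ] ℝ) → ℝ) → ℝ, Measurable w ∧ ∀ x, u x = w (dualEval x) := by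
  obtain ⟨n, ψ, l, hψ, hu⟩ := hu
  exact ⟨fun z => ψ fun i => z (l i), hψ.1.continuous.measurable.comp
    (measurable_pi_iff.2 fun i => measurable_pi_apply (l i)), hu⟩

variable [MeasurableSpace X] [BorelSpace X]

variable [IsTopologicalAddGroup X] [ContinuousSMul ℝ X] [LocallyConvexSpace ℝ X] [T2Space X]

/-- A smooth cylindrical function separating two disjoint compact sets. -/
lemma exists_isCylFun_zero_one {K K' : Set X} (hK : IsCompact K) (hK' : IsCompact K')
    (hd : Disjoint K K') (c : ℝ) :
    ∃ u : X → ℝ, IsCylFun u ∧ (∀ x ∈ K, u x = c) ∧ (∀ x ∈ K', u x = 0) ∧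
      ∀ x, |u x| ≤ |c| ∧ |u x - c| ≤ |c| := by
  obtain ⟨s, hs⟩ := exists_finEval_disjoint hK hK' hd
  let l : Fin s.card → X →L[ℝ] ℝ := fun i => (s.equivFin.symm i).1
  let P : X → Fin s.card → ℝ := fun x i => l i x
  have hP : Continuous P := continuous_pi fun i => (l i).continuous
  have hinj : ∀ x y, P x = P y → finEval s x = finEval s y := by
    intro x y h
    ext m
    have := congrFun h (s.equivFin m)
    simp only [P, l, Equiv.symm_apply_apply] at this
    exact this
  obtain ⟨χ, hχ, h1, h0, hI⟩ := exists_isC0Infty_zero_one (hK.image hP) (hK'.image hP)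
    (Set.disjoint_left.2 (by
      rintro _ ⟨x, hx, rfl⟩ ⟨y, hy, hxy⟩
      exact Set.disjoint_left.1 hs ⟨x, hx, rfl⟩ ⟨y, hy, hinj _ _ hxy⟩))
  refine ⟨fun x => c * χ (P x), ⟨_, _, l, hχ.isCbInfty.const_mul c, fun x => rfl⟩, fun x hx => ?_,
    fun x hx => ?_, fun x => ⟨?_, ?_⟩⟩
  · simp [h1 (Set.mem_image_of_mem P hx)]
  · simp [h0 (Set.mem_image_of_mem P hx)]
  · rw [abs_mul, abs_of_nonneg (hI (P x)).1]
    exact mul_le_of_le_one_right (abs_nonneg c) (hI (P x)).2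
  · rw [← mul_sub_one, abs_mul, abs_sub_comm, abs_of_nonneg (sub_nonneg.2 (hI (P x)).2)]
    exact mul_le_of_le_one_right (abs_nonneg c) (sub_le_self _ (hI (P x)).1)

variable {γ : Measure X} [IsFiniteMeasure γ] [γ.InnerRegular]

/-- Smooth cylindrical functions are dense in `L¹` of a Radon measure. -/
lemma exists_isCylFun_eLpNorm_sub_le {f : X → ℝ} (hf : MemLp f 1 γ) {ε : ℝ≥0∞} (hε : ε ≠ 0) :
    ∃ u : X → ℝ, eLpNorm (f - u) 1 γ ≤ ε ∧ IsCylFun u := by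
  refine hf.induction_dense (by simp) IsCylFun (fun c B hB _ ε hε => ?_)
    (fun _ _ => IsCylFun.add) (fun u hu => hu.continuous.measurable.aestronglyMeasurable) hε
  -- The approximant is wrong only on a set of measure at most 2δ, by at most |c|; the added 1 keeps
  -- the denominator nonzero when c = 0.
  set δ : ℝ≥0∞ := ε / (2 * (‖c‖ₑ + 1)) with hδ
  have hδ0 : δ ≠ 0 := (ENNReal.div_pos hε (by finiteness)).ne'
  obtain ⟨K, hKB, hK, hlt⟩ := hB.exists_isCompact_lt_add (measure_ne_top γ _) hδ0
  obtain ⟨K', hKB', hK', hlt'⟩ := hB.compl.exists_isCompact_lt_add (measure_ne_top γ _) hδ0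
  obtain ⟨u, hu, h1, h0, hle⟩ := exists_isCylFun_zero_one hK hK'
    (Set.disjoint_left.2 fun x hx hx' => hKB' hx' (hKB hx)) c
  refine ⟨u, ?_, hu⟩
  set N : Set X := (B \ K) ∪ (Bᶜ \ K')
  have hN : MeasurableSet N :=
    (hB.diff hK.measurableSet).union (hB.compl.diff hK'.measurableSet)
  have hγN : γ N ≤ 2 * δ := by
    refine (measure_union_le _ _).trans ?_
    rw [two_mul, measure_sdiff hKB hK.measurableSet.nullMeasurableSet (measure_ne_top _ _),
      measure_sdiff hKB' hK'.measurableSet.nullMeasurableSet (measure_ne_top _ _)]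
    exact add_le_add (tsub_le_iff_left.2 hlt.le) (tsub_le_iff_left.2 hlt'.le)
  have hpt : ∀ x, ‖(u - B.indicator fun _ => c) x‖ ≤ ‖N.indicator (fun _ => c) x‖ := by
    intro x
    by_cases hxB : x ∈ B
    · by_cases hxK : x ∈ K
      · simp [hxB, h1 x hxK]
      · have hxN : x ∈ N := Or.inl ⟨hxB, hxK⟩
        simpa [hxB, hxN] using (hle x).2
    · by_cases hxK : x ∈ K'
      · simp [hxB, h0 x hxK]
      · have hxN : x ∈ N := Or.inr ⟨hxB, hxK⟩
        simpa [hxB, hxN] using (hle x).1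
  refine (eLpNorm_mono hpt).trans ?_
  rw [eLpNorm_indicator_const hN (by simp) (by simp)]
  simp only [ENNReal.toReal_one, div_one, ENNReal.rpow_one]
  calc ‖c‖ₑ * γ N ≤ ‖c‖ₑ * (2 * δ) := by gcongr
    _ ≤ (‖c‖ₑ + 1) * (2 * δ) := by gcongr; exact le_self_add
    _ = (2 * (‖c‖ₑ + 1)) * δ := by ring
    _ ≤ ε := ENNReal.mul_div_le

lemma exists_isCylFun_tendsto_ae {f : X → ℝ} (hf : Integrable f γ) :
    ∃ u : ℕ → X → ℝ, (∀ n, IsCylFun (u n)) ∧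
      ∀ᵐ x ∂γ, Filter.Tendsto (fun n => u n x) Filter.atTop (nhds (f x)) := by
  have h := fun n : ℕ => exists_isCylFun_eLpNorm_sub_le (memLp_one_iff_integrable.2 hf)
    (ε := ((n : ℝ≥0∞) + 1)⁻¹) (by simp)
  choose u hu hcyl using h
  have ht : Filter.Tendsto (fun n => eLpNorm (u n - f) 1 γ) Filter.atTop (nhds 0) := by
    refine tendsto_of_tendsto_of_tendsto_of_le_of_le tendsto_const_nhds
      (ENNReal.tendsto_inv_nat_nhds_zero.comp (Filter.tendsto_add_atTop_nat 1))
      (fun n => zero_le) fun n => ?_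
    rw [eLpNorm_sub_comm]
    simpa using hu n
  obtain ⟨ns, -, hns⟩ := (tendstoInMeasure_of_tendsto_eLpNorm one_ne_zero
    (fun n => (hcyl n).continuous.measurable.aestronglyMeasurable) hf.1 ht).exists_seq_tendsto_ae
  exact ⟨fun n => u (ns n), fun n => hcyl _, hns⟩

/-- Integrable functions for a Radon measure are measurable functions of the functionals, up to
null sets. -/
lemma exists_ae_eq_comp_dualEval {f : X → ℝ} (hf : Integrable f γ) :
    ∃ g : ((X →L[ℝ] ℝ) → ℝ) → ℝ, Measurable g ∧ f =ᵐ[γ] g ∘ dualEval := by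
  obtain ⟨u, hu, ht⟩ := exists_isCylFun_tendsto_ae hf
  choose w hw huw using fun n => (hu n).eq_comp_dualEval
  -- The limsup is measurable on all of ℝ^{X^*}, whether or not the sequence converges there; it
  -- equals f wherever the approximants converge to f.
  refine ⟨fun z => Filter.limsup (fun n => w n z) Filter.atTop, .limsup hw, ?_⟩
  filter_upwards [ht] with x hx
  simp only [huw] at hx
  exact hx.limsup_eq.symm

/-- Bounded functions are a.e. limits of smooth cylindrical functions with the same bound. -/
lemma exists_isCylFun_tendsto_ae_of_bound {φ : X → ℝ} (hφ : AEStronglyMeasurable φ γ) {B : ℝ}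
    (hB : 0 < B) (hφB : ∀ x, |φ x| ≤ B) :
    ∃ u : ℕ → X → ℝ, (∀ n, IsCylFun (u n)) ∧ (∀ n x, |u n x| ≤ B) ∧
      ∀ᵐ x ∂γ, Filter.Tendsto (fun n => u n x) Filter.atTop (nhds (φ x)) := by
  -- Approximating arcsin(φ / B) and then applying B sin keeps the approximants cylindrical and
  -- bounded by B.
  have hint : Integrable (fun x => Real.arcsin (φ x / B)) γ := by
    refine Integrable.of_bound (Real.continuous_arcsin.comp_aestronglyMeasurable
      ((continuous_id.div_const B).comp_aestronglyMeasurable hφ)) (Real.pi / 2) (.of_forall fun x => ?_)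
    exact abs_le.2 ⟨Real.neg_pi_div_two_le_arcsin _, Real.arcsin_le_pi_div_two _⟩
  obtain ⟨v, hv, ht⟩ := exists_isCylFun_tendsto_ae hint
  refine ⟨fun n x => B * Real.sin (v n x), fun n => (hv n).const_mul_sin B, fun n x => ?_, ?_⟩
  · rw [abs_mul, abs_of_pos hB]
    exact mul_le_of_le_one_right hB.le (Real.abs_sin_le_one _)
  · filter_upwards [ht] with x hx
    have h := ((Real.continuous_sin.tendsto _).comp hx).const_mul B
    have hab := abs_le.1 (hφB x)
    rwa [Real.sin_arcsin (by rw [le_div_iff₀ hB]; linarith) (by rw [div_le_one hB]; exact hab.2),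
      mul_div_cancel₀ _ hB.ne'] at h

end Cylinder

/-! ### Mixed norms on a product -/

section MixedNorm

variable {α β : Type*} [MeasurableSpace α] [MeasurableSpace β] {ν : Measure α} {μ : Measure β}

/-- Tonelli's theorem for finite q; for q = ∞, almost every section obeys the global essential
bound. -/
lemma eLpNorm_eLpNorm_le [SFinite ν] [SFinite μ] {G : α × β → ℝ}
    (hG : AEStronglyMeasurable G (ν.prod μ)) (q : ℝ≥0∞) (hq : q ≠ 0) :
    eLpNorm (fun x => eLpNorm (fun y => G (x, y)) q μ) q ν ≤ eLpNorm G q (ν.prod μ) := by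
  by_cases htop : q = ⊤
  · subst htop
    simp only [eLpNorm_exponent_top]
    have h : ∀ᵐ z ∂(ν.prod μ), ‖G z‖ₑ ≤ eLpNormEssSup G (ν.prod μ) := ae_le_eLpNormEssSup
    refine essSup_le_of_ae_le _ ?_
    filter_upwards [Measure.ae_ae_of_ae_prod h] with x hx
    rw [enorm_eq_self]
    exact essSup_le_of_ae_le _ hx
  · have hr : 0 < q.toReal := ENNReal.toReal_pos hq htop
    simp only [eLpNorm_eq_lintegral_rpow_enorm_toReal hq htop, enorm_eq_self, ← ENNReal.rpow_mul,
      one_div, inv_mul_cancel₀ hr.ne', ENNReal.rpow_one]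
    rw [lintegral_prod _ (hG.enorm.pow_const _)]

/-- On a probability space the L¹ norm of each section is at most its L^q norm. -/
lemma eLpNorm_integral_le [SFinite ν] [IsProbabilityMeasure μ] {G : α × β → ℝ}
    (hG : AEStronglyMeasurable G (ν.prod μ)) {q : ℝ≥0∞} (hq : 1 ≤ q) :
    eLpNorm (fun x => ∫ y, G (x, y) ∂μ) q ν ≤ eLpNorm G q (ν.prod μ) := by
  refine (eLpNorm_mono_enorm_ae (g := fun x => eLpNorm (fun y => G (x, y)) q μ) ?_).trans
    (eLpNorm_eLpNorm_le hG q (zero_lt_one.trans_le hq).ne')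
  filter_upwards [hG.prodMk_left] with x hx
  rw [enorm_eq_self]
  calc ‖∫ y, G (x, y) ∂μ‖ₑ ≤ ∫⁻ y, ‖G (x, y)‖ₑ ∂μ := enorm_integral_le_lintegral_enorm _
    _ = eLpNorm (fun y => G (x, y)) 1 μ := eLpNorm_one_eq_lintegral_enorm.symm
    _ ≤ _ := eLpNorm_le_eLpNorm_of_exponent_le hq hx

end MixedNorm

/-! ### Computing the L^p norm by cylindrical test functions -/

section Duality

variable {X : Type*} [AddCommGroup X] [Module ℝ X] [TopologicalSpace X]
  [MeasurableSpace X] [BorelSpace X]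
  [IsTopologicalAddGroup X] [ContinuousSMul ℝ X] [LocallyConvexSpace ℝ X] [T2Space X]
  {γ : Measure X} [IsFiniteMeasure γ] [γ.InnerRegular]

lemma tendsto_integral_mul_of_bound {g φ : X → ℝ} {u : ℕ → X → ℝ} {B : ℝ} (hg : Integrable g γ)
    (hu : ∀ n, AEStronglyMeasurable (u n) γ) (hB : ∀ n x, |u n x| ≤ B)
    (ht : ∀ᵐ x ∂γ, Filter.Tendsto (fun n => u n x) Filter.atTop (nhds (φ x))) :
    Filter.Tendsto (fun n => ∫ x, g x * u n x ∂γ) Filter.atTop (nhds (∫ x, g x * φ x ∂γ)) := by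
  refine tendsto_integral_of_dominated_convergence (fun x => |g x| * B)
    (fun n => hg.1.mul (hu n)) (hg.abs.mul_const B) (fun n => .of_forall fun x => ?_) ?_
  · rw [Real.norm_eq_abs, abs_mul]
    gcongr
    exact hB n x
  · filter_upwards [ht] with x hx
    exact hx.const_mul _

lemma tendsto_eLpNorm_of_bound {φ : X → ℝ} {u : ℕ → X → ℝ} {B : ℝ}
    (hu : ∀ n, AEStronglyMeasurable (u n) γ) (hB : ∀ n x, |u n x| ≤ B)
    (ht : ∀ᵐ x ∂γ, Filter.Tendsto (fun n => u n x) Filter.atTop (nhds (φ x)))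
    {q : ℝ≥0∞} (hq : q ≠ 0) (hq' : q ≠ ⊤) :
    Filter.Tendsto (fun n => eLpNorm (u n) q γ) Filter.atTop (nhds (eLpNorm φ q γ)) := by
  simp only [eLpNorm_eq_lintegral_rpow_enorm_toReal hq hq']
  refine ((ENNReal.continuous_rpow_const (y := 1 / q.toReal)).tendsto _).comp ?_
  refine tendsto_lintegral_of_dominated_convergence' (fun _ => ENNReal.ofReal B ^ q.toReal)
    (fun n => (hu n).enorm.pow_const _) (fun n => .of_forall fun x => ?_) ?_ ?_
  · refine ENNReal.rpow_le_rpow ?_ ENNReal.toReal_nonneg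
    rw [Real.enorm_eq_ofReal_abs]
    exact ENNReal.ofReal_le_ofReal (hB n x)
  · rw [lintegral_const]
    exact ENNReal.mul_ne_top (by finiteness) (measure_ne_top _ _)
  · filter_upwards [ht] with x hx
    exact ((ENNReal.continuous_rpow_const (y := q.toReal)).tendsto _).comp
      ((continuous_enorm.tendsto _).comp hx)

/-- The `Lᵖ` norm is controlled by duality with smooth cylindrical functions. -/
theorem eLpNorm_le_of_forall_isCylFun {p : ℝ≥0∞} (hp : 1 ≤ p) (hp_top : p ≠ ⊤) {g : X → ℝ}
    (hg : Integrable g γ) {M : ℝ≥0∞} (hM : M ≠ ⊤)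
    (h : ∀ u : X → ℝ, IsCylFun u →
      ENNReal.ofReal (∫ x, g x * u x ∂γ) ≤ M * eLpNorm u p.conjExponent γ) :
    eLpNorm g p γ ≤ M := by
  have hmeas : ∀ {u : ℕ → X → ℝ}, (∀ n, IsCylFun (u n)) → ∀ n, AEStronglyMeasurable (u n) γ :=
    fun hu n => (hu n).continuous.measurable.aestronglyMeasurable
  rcases hp.eq_or_lt with rfl | hp1
  · have hq : ENNReal.conjExponent 1 = ⊤ := by simp [ENNReal.conjExponent]
    rw [hq] at h
    -- For p = 1 the extremal test function is sign g, reached as an a.e. limit of cylindrical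
    -- functions bounded by 1.
    have hsgn : AEStronglyMeasurable (fun x => SignType.sign (g x) : X → ℝ) γ := by
      have : Measurable fun r : ℝ => ((SignType.sign r : SignType) : ℝ) := by
        have : (fun r : ℝ => ((SignType.sign r : SignType) : ℝ)) =
            fun r => if 0 < r then 1 else if r < 0 then -1 else 0 := by
          ext r
          simp only [sign_apply]
          split_ifs <;> simp
        rw [this]
        exact Measurable.ite measurableSet_Ioi measurable_const
          (Measurable.ite measurableSet_Iio measurable_const measurable_const)
      exact (this.comp_aemeasurable hg.1.aemeasurable).aestronglyMeasurable
    have hsb : ∀ x, |((SignType.sign (g x) : SignType) : ℝ)| ≤ 1 := by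
      intro x
      rcases lt_trichotomy (g x) 0 with h | h | h <;> simp [h]
    obtain ⟨u, hu, hB, ht⟩ := exists_isCylFun_tendsto_ae_of_bound hsgn one_pos hsb
    have h1 := ENNReal.tendsto_ofReal (tendsto_integral_mul_of_bound hg (hmeas hu) hB ht)
    have h2 : ENNReal.ofReal (∫ x, g x * (SignType.sign (g x) : SignType) ∂γ) ≤ M := by
      refine le_of_tendsto' h1 fun n => (h _ (hu n)).trans ?_
      refine mul_le_of_le_one_right' ?_
      rw [eLpNorm_exponent_top]
      refine essSup_le_of_ae_le _ (.of_forall fun x => ?_)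
      simp only [Real.enorm_eq_ofReal_abs]
      exact ENNReal.ofReal_le_one.2 (hB n x)
    simp only [self_mul_sign] at h2
    rw [ofReal_integral_eq_lintegral_ofReal hg.abs (.of_forall fun x => abs_nonneg _)] at h2
    simpa [eLpNorm_one_eq_lintegral_enorm, Real.enorm_eq_ofReal_abs] using h2
  · set q := p.conjExponent with hqdef
    have hpq : p.HolderConjugate q := .conjExponent hp
    have hq_top : q ≠ ⊤ := (ENNReal.HolderConjugate.ne_top_iff_ne_one q p).2 hp1.ne'
    have hq0 : q ≠ 0 := ENNReal.HolderConjugate.ne_zero q p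
    have hp0 : p ≠ 0 := ENNReal.HolderConjugate.ne_zero p q
    have hr := ENNReal.HolderConjugate.toReal_of_ne_top (p := p) (q := q) hp_top hq_top
    set r := p.toReal
    set r' := q.toReal
    have hr0 : 0 < r := hr.pos
    -- The extremal test function sign(g) |g|^{r-1}, truncated where |g| > N because g is only known
    -- to be integrable. It satisfies g φ_N = |φ_N|^{r'} = w_N.
    let w : ℕ → X → ℝ := fun N x => if |g x| ≤ N then |g x| ^ r else 0
    let φ : ℕ → X → ℝ := fun N x => if |g x| ≤ N then SignType.sign (g x) * |g x| ^ (r - 1) else 0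
    have hw0 : ∀ N x, 0 ≤ w N x := fun N x => by
      simp only [w]; split_ifs <;> positivity
    have hφm : ∀ N, AEStronglyMeasurable (φ N) γ := by
      intro N
      have : Measurable fun a : ℝ => if |a| ≤ (N : ℝ) then
          (SignType.sign a : SignType) * |a| ^ (r - 1) else (0 : ℝ) := by
        have e : (fun a : ℝ => if |a| ≤ (N : ℝ) then
            (SignType.sign a : SignType) * |a| ^ (r - 1) else (0 : ℝ)) =
            fun a => if |a| ≤ (N : ℝ) then (if 0 < a then 1 else if a < 0 then -1 else 0) *
              |a| ^ (r - 1) else 0 := by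
          ext a
          simp only [sign_apply]
          split_ifs <;> simp
        rw [e]
        refine Measurable.ite (measurableSet_le (by fun_prop) measurable_const) (Measurable.mul
          (Measurable.ite measurableSet_Ioi measurable_const
          (Measurable.ite measurableSet_Iio measurable_const measurable_const)) (by fun_prop))
          measurable_const
      exact (this.comp_aemeasurable hg.1.aemeasurable).aestronglyMeasurable
    have hsign : ∀ x, |((SignType.sign (g x) : SignType) : ℝ)| ≤ 1 := by
      intro x
      rcases lt_trichotomy (g x) 0 with h | h | h <;> simp [h]
    have hφB : ∀ N x, |φ N x| ≤ (N : ℝ) ^ (r - 1) + 1 := by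
      intro N x
      simp only [φ]
      split_ifs with hx
      · rw [abs_mul, abs_of_nonneg (Real.rpow_nonneg (abs_nonneg (g x)) (r - 1))]
        calc _ ≤ 1 * (N : ℝ) ^ (r - 1) := by
              gcongr
              · exact hsign x
              · exact sub_nonneg.2 hr.lt.le
          _ ≤ _ := by linarith
      · rw [abs_zero]; positivity
    have hgφ : ∀ N x, g x * φ N x = w N x := by
      intro N x
      simp only [φ, w]
      split_ifs with hx
      · rw [← mul_assoc, self_mul_sign]
        by_cases h0 : g x = 0
        · simp [h0, hr0.ne']
        · rw [← Real.rpow_one_add' (abs_nonneg _) (by linarith)]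
          congr 1
          ring
      · simp
    have hφq : ∀ N x, ‖φ N x‖ₑ ^ r' = ENNReal.ofReal (w N x) := by
      intro N x
      rw [Real.enorm_eq_ofReal_abs, ENNReal.ofReal_rpow_of_nonneg (abs_nonneg _) hr.symm.nonneg]
      congr 1
      simp only [φ, w]
      split_ifs with hx
      · by_cases h0 : g x = 0
        · simp [h0, hr0.ne', hr.symm.pos.ne']
        · rw [abs_mul, abs_of_nonneg (Real.rpow_nonneg (abs_nonneg (g x)) (r - 1))]
          have : |((SignType.sign (g x) : SignType) : ℝ)| = 1 := by
            rcases lt_or_gt_of_ne h0 with h | h <;> simp [h]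
          rw [this, one_mul, ← Real.rpow_mul (abs_nonneg _), hr.sub_one_mul_conj]
      · simp [hr.symm.pos.ne']
    have hwint : ∀ N, Integrable (w N) γ := fun N => by
      have := hg.mul_bdd (c := (N : ℝ) ^ (r - 1) + 1) (hφm N) (.of_forall fun x => hφB N x)
      exact this.congr (.of_forall fun x => hgφ N x)
    have hS : ∀ N, ∫⁻ x, ENNReal.ofReal (w N x) ∂γ ≤ M ^ r := by
      intro N
      obtain ⟨u, hu, hB, ht⟩ := exists_isCylFun_tendsto_ae_of_bound (hφm N)
        (by positivity : (0 : ℝ) < (N : ℝ) ^ (r - 1) + 1) (hφB N)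
      have h1 := ENNReal.tendsto_ofReal (tendsto_integral_mul_of_bound hg (hmeas hu) hB ht)
      have h2 := ENNReal.Tendsto.const_mul (a := M)
        (tendsto_eLpNorm_of_bound (hmeas hu) hB ht hq0 hq_top) (Or.inr hM)
      have h3 := le_of_tendsto_of_tendsto' h1 h2 fun n => h _ (hu n)
      simp only [hgφ] at h3
      rw [ofReal_integral_eq_lintegral_ofReal (hwint N) (.of_forall fun x => hw0 N x),
        eLpNorm_eq_lintegral_rpow_enorm_toReal hq0 hq_top] at h3
      simp only [show q.toReal = r' from rfl, hφq] at h3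
      set S := ∫⁻ x, ENNReal.ofReal (w N x) ∂γ
      have hS_top : S ≠ ⊤ := by
        have := (hwint N).2
        rw [hasFiniteIntegral_iff_ofReal (.of_forall fun x => hw0 N x)] at this
        exact this.ne
      by_cases hS0 : S = 0
      · rw [hS0]; exact bot_le
      -- The inequality reads S ≤ M S^{1/r'}. The truncation makes S finite, so S^{1/r'} may be
      -- cancelled.
      have h4 : S ^ (1 / r) ≤ M := by
        have e : S = S ^ (1 / r) * S ^ (1 / r') := by
          rw [← ENNReal.rpow_add _ _ hS0 hS_top, one_div, one_div, hr.inv_add_inv_eq_one,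
            ENNReal.rpow_one]
        have hfin : S ^ (1 / r') ≠ ⊤ := ENNReal.rpow_ne_top_of_nonneg (by
          have := hr.symm.pos; positivity) hS_top
        have hne : S ^ (1 / r') ≠ 0 := by
          simp [ENNReal.rpow_eq_zero_iff, hS0, hS_top]
        rw [e] at h3
        have h5 : S ^ (1 / r) * S ^ (1 / r') ≤ M * S ^ (1 / r') := by
          rwa [← e] at h3 ⊢
        exact (ENNReal.mul_le_mul_iff_left hne hfin).1 h5
      calc S = (S ^ (1 / r)) ^ r := by
            rw [← ENNReal.rpow_mul, one_div, inv_mul_cancel₀ hr0.ne', ENNReal.rpow_one]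
        _ ≤ M ^ r := ENNReal.rpow_le_rpow h4 hr0.le
    have hmono : ∀ x, Monotone fun N => ENNReal.ofReal (w N x) := by
      intro x N N' hNN
      refine ENNReal.ofReal_le_ofReal ?_
      simp only [w]
      by_cases hx : |g x| ≤ N
      · rw [if_pos hx, if_pos (hx.trans (by exact_mod_cast hNN))]
      · rw [if_neg hx]; exact hw0 N' x
    have hsup : ∀ x, ⨆ N, ENNReal.ofReal (w N x) = ‖g x‖ₑ ^ r := by
      intro x
      refine le_antisymm (iSup_le fun N => ?_) ?_
      · rw [Real.enorm_eq_ofReal_abs, ENNReal.ofReal_rpow_of_nonneg (abs_nonneg _) hr0.le]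
        refine ENNReal.ofReal_le_ofReal ?_
        simp only [w]
        split_ifs
        · exact le_rfl
        · positivity
      · obtain ⟨N, hN⟩ := exists_nat_ge |g x|
        refine le_iSup_of_le N ?_
        rw [Real.enorm_eq_ofReal_abs, ENNReal.ofReal_rpow_of_nonneg (abs_nonneg _) hr0.le]
        simp [w, hN]
    rw [eLpNorm_eq_lintegral_rpow_enorm_toReal hp0 hp_top, one_div,
      ENNReal.rpow_inv_le_iff hr0]
    simp only [← show ∀ x, ⨆ N, ENNReal.ofReal (w N x) = ‖g x‖ₑ ^ p.toReal from hsup]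
    rw [lintegral_iSup' (fun N => (hwint N).1.aemeasurable.ennreal_ofReal)
      (.of_forall fun x => hmono x)]
    exact iSup_le hS

end Duality

/-! ### The Mehler operator: rotation invariance, null sets, symmetry -/

section Mehler

variable {X : Type*} [AddCommGroup X] [Module ℝ X] [TopologicalSpace X]
  [MeasurableSpace X] [BorelSpace X]

/-- The Mehler operator `f ↦ ∫ f (c x + s y) γ(dy)`. -/
noncomputable def mehler (γ : Measure X) (c s : ℝ) (f : X → ℝ) (x : X) : ℝ :=
  ∫ y, f (c • x + s • y) ∂γ

/-- Measurability holds for the product σ-algebra after evaluating functionals, even where (x, y) ↦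
c x + s y itself is not measurable into X. -/
lemma measurable_dualEval_mix (c s : ℝ) :
    Measurable fun z : X × X => dualEval (c • z.1 + s • z.2) := by
  refine measurable_pi_iff.2 fun l => ?_
  have hl : Measurable l := l.continuous.measurable
  simp only [dualEval, map_add, map_smul, smul_eq_mul]
  fun_prop

variable {γ : Measure X} [IsGaussian γ] (hc : ∀ l : X →L[ℝ] ℝ, ∫ x, l x ∂γ = 0)
include hc

lemma integral_cexp_prod (l m : X →L[ℝ] ℝ) :
    ∫ z : X × X, Complex.exp ((l z.1 + m z.2 : ℝ) * Complex.I) ∂(γ.prod γ) =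
      Complex.exp (-((covar γ l l + covar γ m m : ℝ) : ℂ) / 2) := by
  have e : ∀ z : X × X, Complex.exp ((l z.1 + m z.2 : ℝ) * Complex.I) =
      Complex.exp ((l z.1 : ℝ) * Complex.I) * Complex.exp ((m z.2 : ℝ) * Complex.I) := by
    intro z
    rw [← Complex.exp_add]
    congr 1
    push_cast
    ring
  simp_rw [e]
  rw [integral_prod_mul (fun x => Complex.exp ((l x : ℝ) * Complex.I))
    (fun x => Complex.exp ((m x : ℝ) * Complex.I)), integral_cexp_functional_mul_I hc,
    integral_cexp_functional_mul_I hc, ← Complex.exp_add]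
  congr 1
  push_cast
  ring

variable {c s : ℝ} (hcs : c ^ 2 + s ^ 2 = 1)
include hcs

/-- Rotation invariance of a centered Gaussian measure. -/
lemma map_dualEval_mix :
    (γ.prod γ).map (fun z : X × X => dualEval (c • z.1 + s • z.2)) = γ.map dualEval := by
  refine map_dualEval_eq_of_charFun (measurable_dualEval_mix c s) measurable_dualEval
    (ξ' := fun z : X × X => c • z.1 + s • z.2) (η' := id) (fun _ _ => rfl) (fun _ _ => rfl)
    fun l => ?_
  have h := integral_cexp_prod hc (c • l) (s • l)
  simp only [FunLike.coe_smul, Pi.smul_apply, covar_smul_left, covar_smul_right] at h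
  simp only [map_add, map_smul, id]
  rw [h, integral_cexp_functional_mul_I hc]
  congr 3
  norm_cast
  linear_combination covar γ l l * hcs

/-- The pair `(x, c x + s y)` is exchangeable under `γ ⊗ γ`. -/
lemma map_sumElim_mix_swap :
    (γ.prod γ).map (fun z : X × X => Sum.elim (dualEval z.1) (dualEval (c • z.1 + s • z.2))) =
      (γ.prod γ).map
        (fun z : X × X => Sum.elim (dualEval (c • z.1 + s • z.2)) (dualEval z.1)) := by
  have hm1 : Measurable fun z : X × X => dualEval z.1 := measurable_dualEval.comp measurable_fst
  have hm2 := measurable_dualEval_mix (X := X) c s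
  have hm : ∀ {F G : X × X → (X →L[ℝ] ℝ) → ℝ}, Measurable F → Measurable G →
      Measurable fun z => Sum.elim (F z) (G z) := by
    intro F G hF hG
    refine measurable_pi_iff.2 fun i => ?_
    cases i with
    | inl l => exact measurable_pi_iff.1 hF l
    | inr l => exact measurable_pi_iff.1 hG l
  refine map_eq_map_of_charFun (hm hm1 hm2) (hm hm2 hm1) fun t a => ?_
  -- The combination equals l on the first block plus m on the second. Exchanging the blocks changes
  -- the variance by a multiple of c² + s² - 1, which is zero.
  set l : X →L[ℝ] ℝ := ∑ i ∈ t, Sum.elim (fun m => a (.inl m) • m) (fun _ => 0) i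
  set m : X →L[ℝ] ℝ := ∑ i ∈ t, Sum.elim (fun _ => 0) (fun m => a (.inr m) • m) i
  have key : ∀ x y : X, ∑ i ∈ t, a i * Sum.elim (dualEval x) (dualEval y) i = l x + m y := by
    intro x y
    simp only [l, m, sum_apply, ← Finset.sum_add_distrib]
    refine Finset.sum_congr rfl fun i _ => ?_
    cases i <;> simp [dualEval]
  simp only [key]
  have h1 := integral_cexp_prod hc (l + c • m) (s • m)
  have h2 := integral_cexp_prod hc (m + c • l) (s • l)
  simp only [FunLike.coe_smul, Pi.smul_apply, covar_smul_left, covar_smul_right, covar_add_left,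
    covar_add_right, add_apply, smul_eq_mul] at h1 h2
  have e1 : ∀ z : X × X, l z.1 + m (c • z.1 + s • z.2) = l z.1 + c * m z.1 + s * m z.2 := by
    intro z; simp only [map_add, map_smul, smul_eq_mul]; ring
  have e2 : ∀ z : X × X, l (c • z.1 + s • z.2) + m z.1 = m z.1 + c * l z.1 + s * l z.2 := by
    intro z; simp only [map_add, map_smul, smul_eq_mul]; ring
  simp only [e1, e2, h1, h2]
  congr 3
  norm_cast
  linear_combination (covar γ m m - covar γ l l) * hcs

lemma eLpNorm_mix {g : ((X →L[ℝ] ℝ) → ℝ) → ℝ} (hg : Measurable g)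
    (q : ℝ≥0∞) :
    eLpNorm (fun z : X × X => g (dualEval (c • z.1 + s • z.2))) q (γ.prod γ) =
      eLpNorm (g ∘ dualEval) q γ := by
  have h := eLpNorm_map_measure (p := q) (μ := γ.prod γ) (g := g)
    hg.aestronglyMeasurable (measurable_dualEval_mix c s).aemeasurable
  rw [map_dualEval_mix hc hcs, eLpNorm_map_measure hg.aestronglyMeasurable
    measurable_dualEval.aemeasurable] at h
  exact h.symm

lemma integral_mix_swap {g w : ((X →L[ℝ] ℝ) → ℝ) → ℝ} (hg : Measurable g) (hw : Measurable w) :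
    ∫ z : X × X, g (dualEval z.1) * w (dualEval (c • z.1 + s • z.2)) ∂(γ.prod γ) =
      ∫ z : X × X, g (dualEval (c • z.1 + s • z.2)) * w (dualEval z.1) ∂(γ.prod γ) := by
  have hm1 : Measurable fun z : X × X => dualEval z.1 := measurable_dualEval.comp measurable_fst
  have hm2 := measurable_dualEval_mix (X := X) c s
  have hm : ∀ {F G : X × X → (X →L[ℝ] ℝ) → ℝ}, Measurable F → Measurable G →
      Measurable fun z => Sum.elim (F z) (G z) := by
    intro F G hF hG
    refine measurable_pi_iff.2 fun i => ?_
    cases i with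
    | inl l => exact measurable_pi_iff.1 hF l
    | inr l => exact measurable_pi_iff.1 hG l
  let F : (((X →L[ℝ] ℝ) ⊕ (X →L[ℝ] ℝ)) → ℝ) → ℝ := fun v => g (v ∘ Sum.inl) * w (v ∘ Sum.inr)
  have hF : Measurable F :=
    (hg.comp (measurable_pi_iff.2 fun l => measurable_pi_apply (Sum.inl l))).mul
      (hw.comp (measurable_pi_iff.2 fun l => measurable_pi_apply (Sum.inr l)))
  have h1 := integral_map (μ := γ.prod γ) (hm hm1 hm2).aemeasurable hF.aestronglyMeasurable
  have h2 := integral_map (μ := γ.prod γ) (hm hm2 hm1).aemeasurable hF.aestronglyMeasurable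
  rw [map_sumElim_mix_swap hc hcs, h2] at h1
  exact h1.symm

variable [IsTopologicalAddGroup X] [ContinuousSMul ℝ X] [LocallyConvexSpace ℝ X] [T2Space X]
  [γ.InnerRegular]

-- A compact part of the section with mass above r stays in the section for nearby base points, by
-- compactness. This replaces Fubini as the source of measurability in x.
omit [IsGaussian γ] hc hcs [LocallyConvexSpace ℝ X] in
lemma isOpen_lt_measure_mix {V : Set X} (hV : IsOpen V) (r : ℝ≥0∞) :
    IsOpen {x : X | r < γ {y | c • x + s • y ∈ V}} := by
  have hcont : Continuous fun z : X × X => c • z.1 + s • z.2 := by fun_prop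
  refine isOpen_iff_mem_nhds.2 fun x hx => ?_
  have hVx : MeasurableSet {y | c • x + s • y ∈ V} :=
    (hV.preimage (hcont.comp (Continuous.prodMk_right x))).measurableSet
  obtain ⟨Q, hQV, hQ, hlt⟩ := hVx.exists_lt_isCompact hx
  have := hQ.eventually_forall_of_forall_eventually (x₀ := x)
    (P := fun x y => c • x + s • y ∈ V) fun y hy =>
      hcont.continuousAt.eventually_mem (hV.mem_nhds (hQV hy))
  filter_upwards [this] with x' hx'
  exact hlt.trans_le (measure_mono hx')

/-- Chebyshev's inequality for the kernel, proved first for cylindrical open sets V I contained in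
Kᶜ, where Tonelli and rotation invariance apply. The corresponding open sets U I are directed and
cover the level set for Kᶜ; inner regularity reduces to a compact subset of it, which lies in a
single U I. -/
lemma measure_lt_measure_mix_le {K : Set X} (hK : IsCompact K) {r : ℝ≥0∞} (hr : r ≠ 0)
    (hr' : r ≠ ⊤) : γ {x | r < γ {y | c • x + s • y ∈ Kᶜ}} ≤ γ Kᶜ / r := by
  classical
  let V : Finset (X →L[ℝ] ℝ) → Set X := fun I => (finEval I ⁻¹' (finEval I '' K))ᶜ
  have hVo : ∀ I, IsOpen (V I) := fun I =>
    ((hK.image (continuous_finEval I)).isClosed.preimage (continuous_finEval I)).isOpen_compl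
  have hVmono : Monotone V := by
    intro I I' hII
    refine Set.compl_subset_compl.2 ?_
    rintro x ⟨k, hk, hkx⟩
    exact ⟨k, hk, funext fun l => congrFun hkx ⟨l.1, hII l.2⟩⟩
  have hVK : ∀ I, V I ⊆ Kᶜ := fun I =>
    Set.compl_subset_compl.2 (Set.subset_preimage_image (finEval I) K)
  let U : Finset (X →L[ℝ] ℝ) → Set X := fun I => {x | r < γ {y | c • x + s • y ∈ V I}}
  have hUo : ∀ I, IsOpen (U I) := fun I => isOpen_lt_measure_mix (hVo I) r
  have hUle : ∀ I, γ (U I) ≤ γ Kᶜ / r := by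
    intro I
    have hA : MeasurableSet (finEval I '' K) := (hK.image (continuous_finEval I)).measurableSet
    have hpre : MeasurableSet (I.restrict ⁻¹' (finEval I '' K)ᶜ : Set ((X →L[ℝ] ℝ) → ℝ)) :=
      Finset.measurable_restrict I hA.compl
    have hS : MeasurableSet {z : X × X | c • z.1 + s • z.2 ∈ V I} :=
      measurable_dualEval_mix c s hpre
    have hlaw := congrArg (fun ρ => ρ (I.restrict ⁻¹' (finEval I '' K)ᶜ))
      (map_dualEval_mix hc hcs)
    simp only [Measure.map_apply measurable_dualEval hpre,
      Measure.map_apply (measurable_dualEval_mix c s) hpre] at hlaw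
    have hlaw' : (γ.prod γ) {z : X × X | c • z.1 + s • z.2 ∈ V I} = γ (V I) := hlaw
    rw [Measure.prod_apply hS] at hlaw'
    calc γ (U I) ≤ γ {x | r ≤ γ {y | c • x + s • y ∈ V I}} :=
          measure_mono fun x (hx : r < _) => hx.le
      _ ≤ (∫⁻ x, γ {y | c • x + s • y ∈ V I} ∂γ) / r :=
          meas_ge_le_lintegral_div (measurable_measure_prodMk_left hS).aemeasurable hr hr'
      _ = γ (V I) / r := by rw [← hlaw']; rfl
      _ ≤ _ := ENNReal.div_le_div_right (measure_mono (hVK I)) r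
  have hsub : {x | r < γ {y | c • x + s • y ∈ Kᶜ}} ⊆ ⋃ I, U I := by
    intro x hx
    have hcont : Continuous fun y : X => c • x + s • y := by fun_prop
    have hmeas : MeasurableSet {y | c • x + s • y ∈ Kᶜ} :=
      (hK.isClosed.isOpen_compl.preimage hcont).measurableSet
    obtain ⟨Q, hQV, hQ, hlt⟩ := hmeas.exists_lt_isCompact hx
    obtain ⟨I, hI⟩ := exists_finEval_disjoint hK (hQ.image hcont) (Set.disjoint_left.2 (by
      rintro _ hk ⟨y, hy, rfl⟩
      exact hQV hy hk))
    refine Set.mem_iUnion.2 ⟨I, hlt.trans_le (measure_mono fun y hy hy' => ?_)⟩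
    exact Set.disjoint_left.1 hI hy' (Set.mem_image_of_mem _ (Set.mem_image_of_mem _ hy))
  have hopen := isOpen_lt_measure_mix (γ := γ) (c := c) (s := s) hK.isClosed.isOpen_compl r
  rw [hopen.measurableSet.measure_eq_iSup_isCompact]
  refine iSup_le fun Q => iSup_le fun hQ => iSup_le fun hQc => ?_
  obtain ⟨I, hI⟩ := hQc.elim_directed_cover U hUo (hQ.trans hsub)
    (Monotone.directed_le fun I I' hII x (hx : r < γ {y | c • x + s • y ∈ V I}) =>
      show r < γ {y | c • x + s • y ∈ V I'} from
        hx.trans_le (measure_mono fun y hy => hVmono hII hy))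
  exact (measure_mono hI).trans (hUle I)

/-- Null sets stay null under the Mehler kernel, for almost every base point. -/
theorem ae_measure_mix_eq_zero {N : Set X} (hN : γ N = 0) :
    ∀ᵐ x ∂γ, γ {y | c • x + s • y ∈ N} = 0 := by
  have key : ∀ r : ℝ≥0∞, r ≠ 0 → r ≠ ⊤ → γ {x | r < γ {y | c • x + s • y ∈ N}} = 0 := by
    intro r hr hr'
    refine le_antisymm (ENNReal.le_of_forall_pos_le_add fun ε hε _ => ?_) bot_le
    -- The complement of K gets measure at most ε r so that Chebyshev's division by r leaves ε.
    have hδ : (ε : ℝ≥0∞) * r ≠ 0 := mul_ne_zero (by exact_mod_cast hε.ne') hr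
    obtain ⟨K, hKN, hK, hlt⟩ := (measurableSet_toMeasurable γ N).compl.exists_isCompact_lt_add
      (measure_ne_top γ _) hδ
    have hNc : γ (toMeasurable γ N)ᶜ = 1 := by
      rw [prob_compl_eq_one_iff (measurableSet_toMeasurable γ N), measure_toMeasurable, hN]
    have hKc : γ Kᶜ ≤ ε * r := by
      rw [prob_compl_eq_one_sub hK.measurableSet, tsub_le_iff_left, ← hNc]
      exact hlt.le
    calc γ {x | r < γ {y | c • x + s • y ∈ N}} ≤ γ {x | r < γ {y | c • x + s • y ∈ Kᶜ}} :=
          measure_mono fun x (hx : r < γ {y | c • x + s • y ∈ N}) =>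
            show r < γ {y | c • x + s • y ∈ Kᶜ} from hx.trans_le
              (measure_mono fun y hy hy' => hKN hy' (subset_toMeasurable γ N hy))
      _ ≤ γ Kᶜ / r := measure_lt_measure_mix_le hc hcs hK hr hr'
      _ ≤ ε * r / r := ENNReal.div_le_div_right hKc r
      _ = ε := ENNReal.mul_div_cancel_right hr hr'
      _ ≤ 0 + ε := by rw [zero_add]
  rw [ae_iff]
  refine measure_mono_null (t := ⋃ n : ℕ, {x | ((n : ℝ≥0∞) + 1)⁻¹ < γ {y | c • x + s • y ∈ N}})
    (fun x hx => ?_) (measure_iUnion_null fun n => key _ (by simp) (by simp))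
  obtain ⟨n, hn⟩ := ENNReal.exists_inv_nat_lt hx
  exact Set.mem_iUnion.2 ⟨n, (ENNReal.inv_le_inv.2 le_self_add).trans_lt hn⟩

lemma ae_ae_mix_eq {f g : X → ℝ} (h : f =ᵐ[γ] g) :
    ∀ᵐ x ∂γ, (fun y => f (c • x + s • y)) =ᵐ[γ] fun y => g (c • x + s • y) :=
  ae_measure_mix_eq_zero hc hcs (ae_iff.1 h)

variable {f : X → ℝ} {p : ℝ≥0∞}

/-- After replacing f by a measurable function of the functionals, the integrand is jointly
measurable and has under γ ⊗ γ the law of f under γ; Jensen's inequality on sections then gives the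
contraction. -/
theorem mehler_facts (hp : 1 ≤ p) (hf : MemLp f p γ) :
    (∀ᵐ x ∂γ, Integrable (fun y => f (c • x + s • y)) γ) ∧ MemLp (mehler γ c s f) p γ ∧
      eLpNorm (mehler γ c s f) p γ ≤ eLpNorm f p γ := by
  obtain ⟨g, hg, hfg⟩ := exists_ae_eq_comp_dualEval (hf.integrable hp)
  have hsec := ae_ae_mix_eq hc hcs hfg
  set G : X × X → ℝ := fun z => g (dualEval (c • z.1 + s • z.2))
  have hGm : Measurable G := hg.comp (measurable_dualEval_mix c s)
  have hG : ∀ q, eLpNorm G q (γ.prod γ) = eLpNorm f q γ := fun q => by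
    rw [eLpNorm_congr_ae hfg]
    exact eLpNorm_mix hc hcs hg q
  have hGint : Integrable G (γ.prod γ) :=
    memLp_one_iff_integrable.1 ⟨hGm.aestronglyMeasurable, by
      rw [hG]; exact (memLp_one_iff_integrable.2 (hf.integrable hp)).2⟩
  have heq : mehler γ c s f =ᵐ[γ] fun x => ∫ y, G (x, y) ∂γ := by
    filter_upwards [hsec] with x hx
    exact integral_congr_ae hx
  have hle : eLpNorm (mehler γ c s f) p γ ≤ eLpNorm f p γ := by
    rw [eLpNorm_congr_ae heq, ← hG]
    exact eLpNorm_integral_le hGm.aestronglyMeasurable hp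
  refine ⟨?_, ⟨?_, hle.trans_lt hf.2⟩, hle⟩
  · filter_upwards [hsec, hGint.prod_right_ae] with x hx hxi
    exact hxi.congr hx.symm
  · exact (hGint.integral_prod_left.1).congr heq.symm

/-- The Mehler operator is symmetric. -/
theorem integral_mehler_mul (hf : Integrable f γ) {u : X → ℝ} (hu : IsCylFun u) :
    ∫ x, mehler γ c s f x * u x ∂γ = ∫ x, f x * mehler γ c s u x ∂γ := by
  obtain ⟨g, hg, hfg⟩ := exists_ae_eq_comp_dualEval hf
  obtain ⟨w, hw, huw⟩ := hu.eq_comp_dualEval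
  obtain ⟨M, hM⟩ := hu.bounded
  have hsec := ae_ae_mix_eq hc hcs hfg
  set G : X × X → ℝ := fun z => g (dualEval (c • z.1 + s • z.2))
  have hGm : Measurable G := hg.comp (measurable_dualEval_mix c s)
  have hGint : Integrable G (γ.prod γ) :=
    memLp_one_iff_integrable.1 ⟨hGm.aestronglyMeasurable, by
      rw [eLpNorm_mix hc hcs hg, ← eLpNorm_congr_ae hfg]
      exact (memLp_one_iff_integrable.2 hf).2⟩
  have hgint : Integrable (fun z : X × X => g (dualEval z.1)) (γ.prod γ) :=
    (hf.congr hfg).comp_fst γ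
  have hw1 : Measurable fun z : X × X => w (dualEval z.1) :=
    hw.comp (measurable_dualEval.comp measurable_fst)
  have hw2 : Measurable fun z : X × X => w (dualEval (c • z.1 + s • z.2)) :=
    hw.comp (measurable_dualEval_mix c s)
  have hwM : ∀ x, ‖w (dualEval x)‖ ≤ M := fun x => by rw [← huw]; exact hM x
  have h1 : ∫ x, mehler γ c s f x * u x ∂γ = ∫ z, G z * w (dualEval z.1) ∂(γ.prod γ) := by
    rw [integral_prod _ (hGint.mul_bdd hw1.aestronglyMeasurable (.of_forall fun z => hwM _))]
    refine integral_congr_ae ?_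
    filter_upwards [hsec] with x hx
    rw [integral_mul_const, huw x]
    congr 1
    exact integral_congr_ae hx
  have h2 : ∫ x, f x * mehler γ c s u x ∂γ =
      ∫ z : X × X, g (dualEval z.1) * w (dualEval (c • z.1 + s • z.2)) ∂(γ.prod γ) := by
    rw [integral_prod _ (hgint.mul_bdd hw2.aestronglyMeasurable (.of_forall fun z => hwM _))]
    refine integral_congr_ae ?_
    filter_upwards [hfg] with x hx
    rw [integral_const_mul, hx]
    simp only [mehler, huw, Function.comp_apply]
  rw [h1, h2, integral_mix_swap hc hcs hg hw]

end Mehler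

/-! ### Smoothness of integrals of affine compositions -/

section ParametricIntegral

/-- Smooth maps all of whose derivatives are bounded. -/
def IsBddSmooth {E F : Type*} [NormedAddCommGroup E] [NormedSpace ℝ E] [NormedAddCommGroup F]
    [NormedSpace ℝ F] (φ : E → F) : Prop :=
  ContDiff ℝ ∞ φ ∧ ∀ k : ℕ, ∃ M : ℝ, ∀ x, ‖iteratedFDeriv ℝ k φ x‖ ≤ M

lemma IsBddSmooth.fderiv {E F : Type*} [NormedAddCommGroup E] [NormedSpace ℝ E]
    [NormedAddCommGroup F] [NormedSpace ℝ F] {φ : E → F} (h : IsBddSmooth φ) :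
    IsBddSmooth (fderiv ℝ φ) := by
  refine ⟨h.1.fderiv_right (by simp), fun k => ?_⟩
  obtain ⟨M, hM⟩ := h.2 (k + 1)
  exact ⟨M, fun x => by rw [norm_iteratedFDeriv_fderiv]; exact hM x⟩

lemma IsBddSmooth.bounded {E F : Type*} [NormedAddCommGroup E] [NormedSpace ℝ E]
    [NormedAddCommGroup F] [NormedSpace ℝ F] {φ : E → F} (h : IsBddSmooth φ) :
    ∃ M : ℝ, 0 ≤ M ∧ ∀ x, ‖φ x‖ ≤ M := by
  obtain ⟨M, hM⟩ := h.2 0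
  simp only [norm_iteratedFDeriv_zero] at hM
  exact ⟨M, (norm_nonneg _).trans (hM 0), hM⟩

variable {E : Type} [NormedAddCommGroup E] [NormedSpace ℝ E] [SecondCountableTopology E]
  [MeasurableSpace E] [BorelSpace E]
  {Ω : Type*} [MeasurableSpace Ω] {μ : Measure Ω} [IsFiniteMeasure μ]
  {a : Ω → ℝ} {b : Ω → E}

lemma aestronglyMeasurable_affine_comp {F : Type*} [NormedAddCommGroup F] [NormedSpace ℝ F]
    (ha : Measurable a) (hb : Measurable b) {w : Ω → ℝ} (hw : Measurable w) {φ : E → F}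
    (hφ : Continuous φ) (z : E) : AEStronglyMeasurable (fun o => w o • φ (a o • z + b o)) μ := by
  have h : Measurable fun o => a o • z + b o := (ha.smul_const z).add hb
  exact (hw.stronglyMeasurable.smul
    (hφ.comp_stronglyMeasurable h.stronglyMeasurable)).aestronglyMeasurable

lemma integrable_affine_comp {F : Type*} [NormedAddCommGroup F] [NormedSpace ℝ F]
    (ha : Measurable a) (hb : Measurable b) {w : Ω → ℝ} (hw : Measurable w) {B : ℝ}
    (hwB : ∀ o, |w o| ≤ B) {φ : E → F} (hφ : IsBddSmooth φ) (z : E) :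
    Integrable (fun o => w o • φ (a o • z + b o)) μ := by
  obtain ⟨M, hM0, hM⟩ := hφ.bounded
  refine Integrable.of_bound (aestronglyMeasurable_affine_comp ha hb hw hφ.1.continuous z)
    (B * M) (.of_forall fun o => ?_)
  rw [norm_smul, Real.norm_eq_abs]
  exact mul_le_mul (hwB o) (hM _) (norm_nonneg _) ((abs_nonneg _).trans (hwB o))

lemma hasFDerivAt_integral_affine_comp {F : Type*} [NormedAddCommGroup F] [NormedSpace ℝ F]
    (ha : Measurable a) (hb : Measurable b) (ha1 : ∀ o, |a o| ≤ 1) {w : Ω → ℝ} (hw : Measurable w)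
    {B : ℝ} (hwB : ∀ o, |w o| ≤ B) {φ : E → F} (hφ : IsBddSmooth φ) (z : E) :
    HasFDerivAt (fun z => ∫ o, w o • φ (a o • z + b o) ∂μ)
      (∫ o, (w o * a o) • fderiv ℝ φ (a o • z + b o) ∂μ) z := by
  obtain ⟨M, hM0, hM⟩ := hφ.fderiv.bounded
  have hφd : Differentiable ℝ φ := hφ.1.differentiable (by simp)
  refine hasFDerivAt_integral_of_dominated_of_fderiv_le (s := Set.univ) (bound := fun _ => B * M)
    (F' := fun z o => (w o * a o) • fderiv ℝ φ (a o • z + b o)) Filter.univ_mem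
    (.of_forall fun z => aestronglyMeasurable_affine_comp ha hb hw hφ.1.continuous z)
    (integrable_affine_comp ha hb hw hwB hφ z)
    (aestronglyMeasurable_affine_comp ha hb (hw.mul ha) hφ.fderiv.1.continuous z)
    (.of_forall fun o z _ => ?_) (integrable_const _) (.of_forall fun o z _ => ?_)
  · rw [norm_smul, norm_mul, Real.norm_eq_abs, Real.norm_eq_abs]
    have hB0 : 0 ≤ B := (abs_nonneg _).trans (hwB o)
    calc |w o| * |a o| * ‖fderiv ℝ φ (a o • z + b o)‖ ≤ B * 1 * M := by
          gcongr
          · exact hwB o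
          · exact ha1 o
          · exact hM _
      _ = B * M := by ring
  · have h1 : HasFDerivAt (fun z : E => a o • z + b o) (a o • ContinuousLinearMap.id ℝ E) z :=
      ((hasFDerivAt_id z).const_smul (a o)).add_const (b o)
    have h2 := ((hφd (a o • z + b o)).hasFDerivAt.comp z h1).const_smul (w o)
    refine h2.congr_fderiv ?_
    ext v
    simp [mul_smul]

/-- The derivative is an integral of the same form, with weight w a and with φ replaced by its
derivative. As |a| ≤ 1 the weight bound persists, so induction applies with w and φ free. -/
lemma contDiff_integral_affine_comp (ha : Measurable a) (hb : Measurable b)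
    (ha1 : ∀ o, |a o| ≤ 1) (k : ℕ) {F : Type} [NormedAddCommGroup F] [NormedSpace ℝ F]
    {w : Ω → ℝ} (hw : Measurable w) {B : ℝ} (hwB : ∀ o, |w o| ≤ B) {φ : E → F}
    (hφ : IsBddSmooth φ) : ContDiff ℝ k (fun z => ∫ o, w o • φ (a o • z + b o) ∂μ) := by
  induction k generalizing F w with
  | zero =>
    exact contDiff_zero.2 (continuous_iff_continuousAt.2 fun z =>
      (hasFDerivAt_integral_affine_comp ha hb ha1 hw hwB hφ z).continuousAt)
  | succ k ih =>
    have hd := hasFDerivAt_integral_affine_comp (μ := μ) ha hb ha1 hw hwB hφ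
    push_cast
    refine contDiff_succ_iff_fderiv.2 ⟨fun z => (hd z).differentiableAt, by simp, ?_⟩
    rw [funext fun z => (hd z).fderiv]
    refine ih (hw.mul ha) (fun o => ?_) hφ.fderiv
    rw [Pi.mul_apply, abs_mul]
    exact (mul_le_of_le_one_right (abs_nonneg _) (ha1 o)).trans (hwB o)

end ParametricIntegral

/-! ### The divergence of a cylindrical field -/

section Divergence

variable {X : Type*} [AddCommGroup X] [Module ℝ X] [TopologicalSpace X]
  [MeasurableSpace X] [BorelSpace X] {γ : Measure X} [IsGaussian γ]
  (hc : ∀ l : X →L[ℝ] ℝ, ∫ x, l x ∂γ = 0)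
  [IsTopologicalAddGroup X] [ContinuousSMul ℝ X] [LocallyConvexSpace ℝ X] [T2Space X]
  [γ.InnerRegular]

omit [MeasurableSpace X] [BorelSpace X] [IsTopologicalAddGroup X] [ContinuousSMul ℝ X]
  [LocallyConvexSpace ℝ X] [T2Space X] in
lemma hasLineDerivAt_comp_clm {E : Type*} [NormedAddCommGroup E] [NormedSpace ℝ E]
    {φ : E → ℝ} (hφ : Differentiable ℝ φ) (P : X →L[ℝ] E) (x h : X) :
    HasLineDerivAt ℝ (fun x => φ (P x)) (fderiv ℝ φ (P x) (P h)) x h := by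
  have h1 : HasDerivAt (fun t : ℝ => P x + t • P h) (P h) 0 := by
    simpa using ((hasDerivAt_id (0 : ℝ)).smul_const (P h)).const_add (P x)
  have h2 : HasFDerivAt φ (fderiv ℝ φ (P x)) (P x + (0 : ℝ) • P h) := by
    simpa using (hφ (P x)).hasFDerivAt
  have h3 := h2.comp_hasDerivAt (0 : ℝ) h1
  refine HasDerivAt.congr_of_eventuallyEq h3 (.of_forall fun t => ?_)
  simp

include hc

/-- The divergence of a smooth compactly supported cylindrical vector field. -/
theorem isGaussDiv_sum {n : ℕ} {l : Fin n → X →L[ℝ] ℝ} {h : Fin n → X}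
    (hh : ∀ i, ∀ m : X →L[ℝ] ℝ, m (h i) = covar γ (l i) m) {Θ : Fin n → (Fin n → ℝ) → ℝ}
    (hΘ : ∀ i, IsC0Infty (Θ i)) :
    IsGaussDiv γ (fun x => ∑ i, Θ i (ContinuousLinearMap.pi l x) • h i)
      (fun x => ∑ i, (fderiv ℝ (Θ i) (ContinuousLinearMap.pi l x)
        (ContinuousLinearMap.pi l (h i)) - Θ i (ContinuousLinearMap.pi l x) * l i x)) := by
  set P : X →L[ℝ] (Fin n → ℝ) := ContinuousLinearMap.pi l with hP
  have hPm : Measurable P := P.continuous.measurable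
  have hΘd : ∀ i, Differentiable ℝ (Θ i) := fun i => (hΘ i).1.differentiable (by simp)
  have hΘb : ∀ i, IsBddSmooth (Θ i) := fun i => (hΘ i).isCbInfty
  have hΘm : ∀ i, Measurable (Θ i) := fun i => (hΘ i).1.continuous.measurable
  have hΘ'm : ∀ i v, Measurable fun z => fderiv ℝ (Θ i) z v := fun i v =>
    ((hΘb i).fderiv.1.continuous.clm_apply continuous_const).measurable
  choose M hM0 hM using fun i => (hΘb i).bounded
  choose M' hM'0 hM' using fun i => (hΘb i).fderiv.bounded
  have hM'v : ∀ i z v, |fderiv ℝ (Θ i) z v| ≤ M' i * ‖v‖ := fun i z v =>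
    ((fderiv ℝ (Θ i) z).le_opNorm v).trans (by gcongr; exact hM' i z)
  have hint1 : ∀ i, Integrable (fun x => fderiv ℝ (Θ i) (P x) (P (h i))) γ := fun i =>
    Integrable.of_bound ((hΘ'm i _).comp hPm).aestronglyMeasurable _
      (.of_forall fun x => hM'v i (P x) _)
  have hint2 : ∀ i, Integrable (fun x => Θ i (P x) * l i x) γ := fun i =>
    (integrable_functional (l i)).bdd_mul (c := M i) ((hΘm i).comp hPm).aestronglyMeasurable
      (.of_forall fun x => hM i (P x))
  refine ⟨integrable_finsetSum _ fun i _ => (hint1 i).sub (hint2 i), ?_⟩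
  rintro φ ⟨m, ψ, l', hψ, hφ⟩
  set L : X →L[ℝ] (Fin m → ℝ) := ContinuousLinearMap.pi l'
  have hφL : φ = fun x => ψ (L x) := funext hφ
  have hLm : Measurable L := L.continuous.measurable
  have hψb : IsBddSmooth ψ := hψ
  have hψd : Differentiable ℝ ψ := hψ.1.differentiable (by simp)
  obtain ⟨N, hN0, hN⟩ := hψb.bounded
  obtain ⟨N', hN'0, hN'⟩ := hψb.fderiv.bounded
  have hψm : Measurable ψ := hψ.1.continuous.measurable
  have hψ'm : ∀ v, Measurable fun z => fderiv ℝ ψ z v := fun v =>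
    (hψb.fderiv.1.continuous.clm_apply continuous_const).measurable
  have hN'v : ∀ z v, |fderiv ℝ ψ z v| ≤ N' * ‖v‖ := fun z v =>
    ((fderiv ℝ ψ z).le_opNorm v).trans (by gcongr; exact hN' z)
  have hline : ∀ x, lineDeriv ℝ φ x (∑ i, Θ i (P x) • h i) =
      ∑ i, Θ i (P x) * fderiv ℝ ψ (L x) (L (h i)) := by
    intro x
    rw [hφL, (hasLineDerivAt_comp_clm hψd L x _).lineDeriv]
    simp [map_sum]
  have hmψ : AEStronglyMeasurable (fun x => ψ (L x)) γ := (hψm.comp hLm).aestronglyMeasurable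
  have hint1' : ∀ i, Integrable (fun x => fderiv ℝ (Θ i) (P x) (P (h i)) * ψ (L x)) γ := fun i =>
    (hint1 i).mul_bdd hmψ (.of_forall fun x => hN _)
  have hint2' : ∀ i, Integrable (fun x => Θ i (P x) * l i x * ψ (L x)) γ := fun i =>
    (hint2 i).mul_bdd hmψ (.of_forall fun x => hN _)
  have hint3 : ∀ i, Integrable (fun x => Θ i (P x) * fderiv ℝ ψ (L x) (L (h i))) γ := fun i =>
    Integrable.of_bound (((hΘm i).comp hPm).mul ((hψ'm _).comp hLm)).aestronglyMeasurable
      (M i * (N' * ‖L (h i)‖)) (.of_forall fun x => by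
        rw [norm_mul]
        exact mul_le_mul (hM i _) (hN'v _ _) (norm_nonneg _) (hM0 i))
  -- Integration by parts along h i for the product of the coefficient Θ i and the test function.
  have hibp : ∀ i, ∫ x, (fderiv ℝ (Θ i) (P x) (P (h i)) * ψ (L x) +
      Θ i (P x) * fderiv ℝ ψ (L x) (L (h i))) ∂γ = ∫ x, Θ i (P x) * ψ (L x) * l i x ∂γ := by
    intro i
    refine integral_lineDeriv_eq hc (hh i) (((hΘm i).comp hPm).mul (hψm.comp hLm))
      ((((hΘ'm i _).comp hPm).mul (hψm.comp hLm)).add (((hΘm i).comp hPm).mul ((hψ'm _).comp hLm)))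
      (B := M i * N) (B' := M' i * ‖P (h i)‖ * N + M i * (N' * ‖L (h i)‖))
      (fun x => ?_) (fun x => ?_) fun x => ?_
    · rw [abs_mul]
      exact mul_le_mul (hM i _) (hN _) (abs_nonneg _) (hM0 i)
    · refine (abs_add_le _ _).trans (add_le_add ?_ ?_)
      · rw [abs_mul]
        exact mul_le_mul (hM'v i _ _) (hN _) (abs_nonneg _)
          (mul_nonneg (hM'0 i) (norm_nonneg _))
      · rw [abs_mul]
        exact mul_le_mul (hM i _) (hN'v _ _) (abs_nonneg _) (hM0 i)
    · have h1 := hasLineDerivAt_comp_clm (hΘd i) P x (h i)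
      have h2 := hasLineDerivAt_comp_clm hψd L x (h i)
      have h3 := HasDerivAt.mul h1 h2
      simp only [zero_smul, add_zero] at h3
      exact h3
  simp only [hline]
  rw [hφL]
  rw [integral_finsetSum _ fun i _ => hint3 i]
  simp only [Finset.sum_mul, sub_mul]
  have hint4 : ∀ i, Integrable (fun x => fderiv ℝ (Θ i) (P x) (P (h i)) * ψ (L x) -
      Θ i (P x) * l i x * ψ (L x)) γ := fun i => (hint1' i).sub (hint2' i)
  rw [integral_finsetSum _ fun i _ => hint4 i, ← Finset.sum_neg_distrib]
  refine Finset.sum_congr rfl fun i _ => ?_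
  have h1 := hibp i
  rw [integral_add (hint1' i) (hint3 i)] at h1
  rw [integral_sub (hint1' i) (hint2' i)]
  have h2 : ∫ x, Θ i (P x) * ψ (L x) * l i x ∂γ = ∫ x, Θ i (P x) * l i x * ψ (L x) ∂γ :=
    integral_congr_ae (.of_forall fun x => by ring)
  rw [h2] at h1
  linarith

end Divergence

/-! ### The averaged gradient field and its derivatives -/

section RotationField

lemma IsBddSmooth.clm_comp {E F G : Type*} [NormedAddCommGroup E] [NormedSpace ℝ E]
    [NormedAddCommGroup F] [NormedSpace ℝ F] [NormedAddCommGroup G] [NormedSpace ℝ G] {φ : E → F}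
    (h : IsBddSmooth φ) (L : F →L[ℝ] G) : IsBddSmooth (fun x => L (φ x)) := by
  refine ⟨L.contDiff.comp h.1, fun k => ?_⟩
  obtain ⟨M, hM⟩ := h.2 k
  refine ⟨‖L‖ * M, fun x => ?_⟩
  refine (L.norm_iteratedFDeriv_comp_left h.1.contDiffAt (by exact_mod_cast le_top)).trans ?_
  gcongr
  exact hM x

variable {X : Type*} [AddCommGroup X] [Module ℝ X] [TopologicalSpace X]
  [MeasurableSpace X]

/-- The product of the uniform distribution on `(0, 1]` and `γ`. -/
noncomputable def unifProd (γ : Measure X) : Measure (ℝ × X) :=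
  ((volume : Measure ℝ).restrict (Set.Ioc 0 1)).prod γ

instance : IsProbabilityMeasure ((volume : Measure ℝ).restrict (Set.Ioc 0 1)) :=
  ⟨by simp⟩

instance (γ : Measure X) [IsProbabilityMeasure γ] : IsProbabilityMeasure (unifProd γ) := by
  unfold unifProd; infer_instance

/-- The averaged gradient `θ ∫₀¹ ∫ sin(θσ) Dψ(cos(θσ) z + sin(θσ) P y) γ(dy) dσ`. -/
noncomputable def rotGrad {E : Type*} [NormedAddCommGroup E] [NormedSpace ℝ E] (γ : Measure X)
    (P : X →L[ℝ] E) (ψ : E → ℝ) (θ : ℝ) (z : E) : E →L[ℝ] ℝ :=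
  ∫ o : ℝ × X, (θ * Real.sin (θ * o.1)) •
    fderiv ℝ ψ (Real.cos (θ * o.1) • z + Real.sin (θ * o.1) • P o.2) ∂(unifProd γ)

variable [BorelSpace X]

section Smoothness

variable {E : Type} [NormedAddCommGroup E] [NormedSpace ℝ E] [SecondCountableTopology E]
  [MeasurableSpace E] [BorelSpace E] {γ : Measure X} [IsProbabilityMeasure γ]
  (P : X →L[ℝ] E) {ψ : E → ℝ} (hψ : IsBddSmooth ψ) (θ : ℝ)

lemma measurable_sin_smul : Measurable fun o : ℝ × X => Real.sin (θ * o.1) • P o.2 := by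
  have hP : Measurable P := P.continuous.measurable
  have h1 : Measurable fun o : ℝ × X => Real.sin (θ * o.1) := by fun_prop
  exact h1.smul (hP.comp measurable_snd)

lemma abs_mul_sin_le (r : ℝ) : |θ * Real.sin r| ≤ |θ| := by
  rw [abs_mul]
  exact mul_le_of_le_one_right (abs_nonneg _) (Real.abs_sin_le_one _)

include hψ

omit hψ in
lemma integrable_rotGrad {F : Type*} [NormedAddCommGroup F] [NormedSpace ℝ F] {φ : E → F}
    (hφ : IsBddSmooth φ) {w : ℝ × X → ℝ} (hw : Measurable w) (hwB : ∀ o, |w o| ≤ |θ|) (z : E) :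
    Integrable (fun o : ℝ × X => w o •
      φ (Real.cos (θ * o.1) • z + Real.sin (θ * o.1) • P o.2)) (unifProd γ) :=
  integrable_affine_comp (by fun_prop) (measurable_sin_smul P θ) hw hwB hφ z

lemma hasFDerivAt_rotGrad (z : E) : HasFDerivAt (rotGrad γ P ψ θ)
    (∫ o : ℝ × X, (θ * Real.sin (θ * o.1) * Real.cos (θ * o.1)) • fderiv ℝ (fderiv ℝ ψ)
      (Real.cos (θ * o.1) • z + Real.sin (θ * o.1) • P o.2) ∂(unifProd γ)) z :=
  hasFDerivAt_integral_affine_comp (a := fun o : ℝ × X => Real.cos (θ * o.1)) (by fun_prop)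
    (measurable_sin_smul P θ) (fun o => Real.abs_cos_le_one _)
    (w := fun o : ℝ × X => θ * Real.sin (θ * o.1)) (by fun_prop)
    (fun o => abs_mul_sin_le θ _) hψ.fderiv z

lemma contDiff_rotGrad : ContDiff ℝ ∞ (rotGrad γ P ψ θ) :=
  contDiff_infty.2 fun k => contDiff_integral_affine_comp
    (a := fun o : ℝ × X => Real.cos (θ * o.1)) (by fun_prop) (measurable_sin_smul P θ)
    (fun o => Real.abs_cos_le_one _) k (w := fun o : ℝ × X => θ * Real.sin (θ * o.1))
    (by fun_prop) (fun o => abs_mul_sin_le θ _) hψ.fderiv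

lemma exists_norm_rotGrad_le : ∃ B, 0 ≤ B ∧ ∀ z, ‖rotGrad γ P ψ θ z‖ ≤ B := by
  obtain ⟨M, hM0, hM⟩ := hψ.fderiv.bounded
  refine ⟨|θ| * M, by positivity, fun z => ?_⟩
  refine (norm_integral_le_of_norm_le_const (C := |θ| * M) (.of_forall fun o => ?_)).trans
    (by simp)
  rw [norm_smul]
  exact mul_le_mul (abs_mul_sin_le θ _) (hM _) (norm_nonneg _) (abs_nonneg _)

lemma rotGrad_apply (z v : E) : rotGrad γ P ψ θ z v =
    ∫ o : ℝ × X, θ * Real.sin (θ * o.1) *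
      fderiv ℝ ψ (Real.cos (θ * o.1) • z + Real.sin (θ * o.1) • P o.2) v ∂(unifProd γ) := by
  rw [rotGrad, ContinuousLinearMap.integral_apply (integrable_rotGrad P θ hψ.fderiv
    (by fun_prop) (fun o => abs_mul_sin_le θ _) z)]
  rfl

lemma fderiv_rotGrad_apply (z u v : E) : fderiv ℝ (rotGrad γ P ψ θ) z u v =
    ∫ o : ℝ × X, θ * Real.sin (θ * o.1) * Real.cos (θ * o.1) * fderiv ℝ (fderiv ℝ ψ)
      (Real.cos (θ * o.1) • z + Real.sin (θ * o.1) • P o.2) u v ∂(unifProd γ) := by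
  have h := integrable_rotGrad (γ := γ) P θ hψ.fderiv.fderiv
    (w := fun o => θ * Real.sin (θ * o.1) * Real.cos (θ * o.1)) (by fun_prop) (fun o => by
      rw [abs_mul]
      exact (mul_le_of_le_one_right (abs_nonneg _) (Real.abs_cos_le_one _)).trans
        (abs_mul_sin_le θ _)) z
  rw [(hasFDerivAt_rotGrad P hψ θ z).fderiv, ContinuousLinearMap.integral_apply h,
    ContinuousLinearMap.integral_apply (h.apply_continuousLinearMap u)]
  rfl

end Smoothness

variable {E : Type} [NormedAddCommGroup E] [NormedSpace ℝ E] [SecondCountableTopology E]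
  [MeasurableSpace E] [BorelSpace E] {γ : Measure X} [IsGaussian γ]
  (hc : ∀ l : X →L[ℝ] ℝ, ∫ x, l x ∂γ = 0)
  [IsTopologicalAddGroup X] [ContinuousSMul ℝ X] [LocallyConvexSpace ℝ X] [T2Space X]
  [γ.InnerRegular] (P : X →L[ℝ] E)
include hc

/-- The chain rule produces the factor s. The weight sin(θσ) in `rotGrad` supplies it, so
integrating by parts in y leaves no division by the sine. -/
lemma integral_fderiv_affine {F : E → ℝ} (hF : IsBddSmooth F) (z : E) (s : ℝ)
    {m : X →L[ℝ] ℝ} {h : X} (hh : ∀ m' : X →L[ℝ] ℝ, m' h = covar γ m m') :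
    ∫ y, s * fderiv ℝ F (z + s • P y) (P h) ∂γ = ∫ y, F (z + s • P y) * m y ∂γ := by
  have hPm : Measurable P := P.continuous.measurable
  have hq : Measurable fun y => z + s • P y := (hPm.const_smul s).const_add z
  have hFd : Differentiable ℝ F := hF.1.differentiable (by simp)
  obtain ⟨M, hM0, hM⟩ := hF.bounded
  obtain ⟨M', hM'0, hM'⟩ := hF.fderiv.bounded
  have hF'm : Measurable fun v => fderiv ℝ F v (P h) :=
    (hF.fderiv.1.continuous.clm_apply continuous_const).measurable
  refine integral_lineDeriv_eq hc hh (hF.1.continuous.measurable.comp hq)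
    ((hF'm.comp hq).const_mul s) (B := M) (B' := |s| * (M' * ‖P h‖)) (fun y => hM _) (fun y => ?_)
    fun y => ?_
  · rw [abs_mul]
    gcongr
    exact ((fderiv ℝ F _).le_opNorm _).trans (by gcongr; exact hM' _)
  · have hd : ∀ v, HasFDerivAt (fun v => F (z + s • v)) (s • fderiv ℝ F (z + s • v)) v := by
      intro v
      have h1 : HasFDerivAt (fun v : E => z + s • v) (s • ContinuousLinearMap.id ℝ E) v :=
        ((hasFDerivAt_id v).const_smul s).const_add z
      refine ((hFd (z + s • v)).hasFDerivAt.comp v h1).congr_fderiv ?_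
      ext u
      simp
    have h2 := hasLineDerivAt_comp_clm (φ := fun v => F (z + s • v))
      (fun v => (hd v).differentiableAt) P y h
    rwa [(hd (P y)).fderiv] at h2

variable {ψ : E → ℝ} (hψ : IsBddSmooth ψ) (θ : ℝ)
include hψ

omit hc hψ [IsTopologicalAddGroup X] [ContinuousSMul ℝ X] [LocallyConvexSpace ℝ X] [T2Space X]
  [γ.InnerRegular] in
lemma integrable_mul_functional {φ : E → ℝ} (hφ : IsBddSmooth φ) (w : ℝ → ℝ) (hw : Measurable w)
    {B : ℝ} (hwB : ∀ r, |w r| ≤ B) (z : E) (m : X →L[ℝ] ℝ) :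
    Integrable (fun o : ℝ × X => w o.1 *
      φ (Real.cos (θ * o.1) • z + Real.sin (θ * o.1) • P o.2) * m o.2) (unifProd γ) := by
  have h1 : Integrable (fun o : ℝ × X => m o.2) (unifProd γ) :=
    (integrable_functional m).comp_snd _
  obtain ⟨M, hM0, hM⟩ := hφ.bounded
  refine h1.bdd_mul (c := B * M) (aestronglyMeasurable_affine_comp (by fun_prop)
    (measurable_sin_smul P θ) (w := fun o => w o.1) (hw.comp measurable_fst) hφ.1.continuous z)
    (.of_forall fun o => ?_)
  rw [norm_mul]
  exact mul_le_mul (hwB _) (hM _) (norm_nonneg _) ((abs_nonneg _).trans (hwB 0))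

/-- The averaged gradient along a Cameron–Martin vector. -/
lemma rotGrad_apply_eq {m : X →L[ℝ] ℝ} {h : X} (hh : ∀ m' : X →L[ℝ] ℝ, m' h = covar γ m m')
    (z : E) : rotGrad γ P ψ θ z (P h) = θ * ∫ o : ℝ × X,
      ψ (Real.cos (θ * o.1) • z + Real.sin (θ * o.1) • P o.2) * m o.2 ∂(unifProd γ) := by
  have h1 := (integrable_rotGrad (γ := γ) P θ hψ.fderiv
    (w := fun o => θ * Real.sin (θ * o.1)) (by fun_prop)
    (fun o => abs_mul_sin_le θ _) z).apply_continuousLinearMap (P h)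
  have h2 := integrable_mul_functional (γ := γ) P θ hψ (fun _ => 1) measurable_const (B := 1)
    (fun _ => by simp) z m
  simp only [one_mul] at h2
  simp only [FunLike.coe_smul, Pi.smul_apply, smul_eq_mul] at h1
  rw [rotGrad_apply P hψ, unifProd, integral_prod _ h1, integral_prod _ h2, ← integral_const_mul]
  refine integral_congr_ae (.of_forall fun r => ?_)
  simp only [mul_assoc]
  rw [integral_const_mul, integral_fderiv_affine hc P hψ _ _ hh]

/-- Differentiation in z contributes cos(θσ) and a second derivative of ψ; integration by parts in y
consumes sin(θσ) and one derivative in exchange for m(y). -/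
lemma fderiv_rotGrad_apply_eq {m : X →L[ℝ] ℝ} {h : X}
    (hh : ∀ m' : X →L[ℝ] ℝ, m' h = covar γ m m') (z v : E) :
    fderiv ℝ (rotGrad γ P ψ θ) z (P h) v = ∫ o : ℝ × X, θ * Real.cos (θ * o.1) *
      fderiv ℝ ψ (Real.cos (θ * o.1) • z + Real.sin (θ * o.1) • P o.2) v * m o.2
        ∂(unifProd γ) := by
  have hF : IsBddSmooth fun u => fderiv ℝ ψ u v :=
    hψ.fderiv.clm_comp (ContinuousLinearMap.apply ℝ ℝ v)
  have hF' : ∀ u, fderiv ℝ (fun u => fderiv ℝ ψ u v) u (P h) =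
      fderiv ℝ (fderiv ℝ ψ) u (P h) v := by
    intro u
    have hd : DifferentiableAt ℝ (fderiv ℝ ψ) u := hψ.fderiv.1.differentiable (by simp) u
    rw [fderiv_clm_apply hd (differentiableAt_const v)]
    simp
  have h1 := ((integrable_rotGrad (γ := γ) P θ hψ.fderiv.fderiv
    (w := fun o => θ * Real.sin (θ * o.1) * Real.cos (θ * o.1)) (by fun_prop) (fun o => by
      rw [abs_mul]
      exact (mul_le_of_le_one_right (abs_nonneg _) (Real.abs_cos_le_one _)).trans
        (abs_mul_sin_le θ _)) z).apply_continuousLinearMap (P h)).apply_continuousLinearMap v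
  have h2 := integrable_mul_functional (γ := γ) P θ hF (fun r => θ * Real.cos (θ * r))
    (by fun_prop) (B := |θ|) (fun r => by
      rw [abs_mul]
      exact mul_le_of_le_one_right (abs_nonneg _) (Real.abs_cos_le_one _)) z m
  simp only [FunLike.coe_smul, Pi.smul_apply, smul_eq_mul] at h1
  rw [fderiv_rotGrad_apply P hψ, unifProd, integral_prod _ h1, integral_prod _ h2]
  refine integral_congr_ae (.of_forall fun r => ?_)
  have h3 := integral_fderiv_affine hc P hF (Real.cos (θ * r) • z) (Real.sin (θ * r)) hh
  simp only [hF'] at h3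
  have e1 : ∀ y, θ * Real.sin (θ * r) * Real.cos (θ * r) * fderiv ℝ (fderiv ℝ ψ)
      (Real.cos (θ * r) • z + Real.sin (θ * r) • P y) (P h) v =
      θ * Real.cos (θ * r) * (Real.sin (θ * r) * fderiv ℝ (fderiv ℝ ψ)
      (Real.cos (θ * r) • z + Real.sin (θ * r) • P y) (P h) v) := fun y => by ring
  simp only [e1, mul_assoc (θ * Real.cos (θ * r))]
  rw [integral_const_mul, h3, integral_const_mul]

end RotationField

/-! ### The Mehler defect as a divergence -/

section RotationDivergence

variable {X : Type*} [AddCommGroup X] [Module ℝ X] [TopologicalSpace X]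
  [MeasurableSpace X] [BorelSpace X] {γ : Measure X} [IsGaussian γ]
  (hc : ∀ l : X →L[ℝ] ℝ, ∫ x, l x ∂γ = 0)
  [IsTopologicalAddGroup X] [ContinuousSMul ℝ X] [LocallyConvexSpace ℝ X] [T2Space X]
  [γ.InnerRegular]
include hc

/-- The divergence of the averaged gradient field is the defect `ψ - T ψ` of the Mehler operator. -/
theorem sum_rotGrad_eq {n : ℕ} {l : Fin n → X →L[ℝ] ℝ} {h : Fin n → X}
    (hh : ∀ i, ∀ m : X →L[ℝ] ℝ, m (h i) = covar γ (l i) m) {ψ : (Fin n → ℝ) → ℝ}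
    (hψ : IsBddSmooth ψ) (θ : ℝ) (x : X) :
    ∑ i, (rotGrad γ (ContinuousLinearMap.pi l) ψ θ (ContinuousLinearMap.pi l x) (Pi.single i 1) *
        l i x - fderiv ℝ (rotGrad γ (ContinuousLinearMap.pi l) ψ θ) (ContinuousLinearMap.pi l x)
          (ContinuousLinearMap.pi l (h i)) (Pi.single i 1)) =
      ψ (ContinuousLinearMap.pi l x) - mehler γ (Real.cos θ) (Real.sin θ)
        (fun y => ψ (ContinuousLinearMap.pi l y)) x := by
  set P : X →L[ℝ] (Fin n → ℝ) := ContinuousLinearMap.pi l with hP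
  have hPm : Measurable P := P.continuous.measurable
  have hψd : Differentiable ℝ ψ := hψ.1.differentiable (by simp)
  obtain ⟨M, hM0, hM⟩ := hψ.bounded
  have hsingle : ∀ y, P y = ∑ i, l i y • (Pi.single i (1 : ℝ) : Fin n → ℝ) := by
    intro y
    ext j
    simp [P, Finset.sum_apply, Pi.single_apply]
  set q : ℝ × X → Fin n → ℝ := fun o => Real.cos (θ * o.1) • P x + Real.sin (θ * o.1) • P o.2
  have hF : ∀ v, IsBddSmooth fun u => fderiv ℝ ψ u v := fun v =>
    hψ.fderiv.clm_comp (ContinuousLinearMap.apply ℝ ℝ v)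
  have hI : ∀ i, Integrable (fun o : ℝ × X => θ * Real.cos (θ * o.1) *
      fderiv ℝ ψ (q o) (Pi.single i 1) * l i o.2) (unifProd γ) := fun i =>
    integrable_mul_functional (γ := γ) P θ (hF _) (fun r => θ * Real.cos (θ * r))
      (by fun_prop) (B := |θ|) (fun r => by
        rw [abs_mul]
        exact mul_le_of_le_one_right (abs_nonneg _) (Real.abs_cos_le_one _)) (P x) (l i)
  -- Each coordinate contributes the factor l i (y), and ∑ l i (y) e_i = P y reassembles the
  -- derivative of ψ in the direction P y.
  have hA : ∑ i, fderiv ℝ (rotGrad γ P ψ θ) (P x) (P (h i)) (Pi.single i 1) =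
      ∫ o, θ * Real.cos (θ * o.1) * fderiv ℝ ψ (q o) (P o.2) ∂(unifProd γ) := by
    simp only [fun i => fderiv_rotGrad_apply_eq hc P hψ θ (hh i) (P x) (Pi.single i 1)]
    rw [← integral_finsetSum _ fun i _ => hI i]
    refine integral_congr_ae (.of_forall fun o => ?_)
    simp only [hsingle o.2, map_sum, map_smul, smul_eq_mul, Finset.mul_sum]
    exact Finset.sum_congr rfl fun i _ => by ring
  have hB : ∑ i, rotGrad γ P ψ θ (P x) (Pi.single i 1) * l i x =
      ∫ o, θ * Real.sin (θ * o.1) * fderiv ℝ ψ (q o) (P x) ∂(unifProd γ) := by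
    rw [← rotGrad_apply P hψ θ (P x) (P x)]
    conv_rhs => rw [hsingle x]
    simp [map_sum, mul_comm, hsingle x]
  have hIA : Integrable (fun o : ℝ × X => θ * Real.cos (θ * o.1) * fderiv ℝ ψ (q o) (P o.2))
      (unifProd γ) := by
    refine (integrable_finsetSum Finset.univ fun i _ => hI i).congr (.of_forall fun o => ?_)
    simp only [hsingle o.2, map_sum, map_smul, smul_eq_mul, Finset.mul_sum]
    exact Finset.sum_congr rfl fun i _ => by ring
  have hIB : Integrable (fun o : ℝ × X => θ * Real.sin (θ * o.1) * fderiv ℝ ψ (q o) (P x))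
      (unifProd γ) :=
    (integrable_rotGrad (γ := γ) P θ hψ.fderiv (w := fun o => θ * Real.sin (θ * o.1))
      (by fun_prop) (fun o => abs_mul_sin_le θ _) (P x)).apply_continuousLinearMap (P x)
  -- The difference of the two integrands is -d/dr ψ(q(r, y)), along the arc from P x to P(cos θ x +
  -- sin θ y).
  have hFTC : ∀ y, ∫ r in Set.Ioc (0 : ℝ) 1,
      (θ * Real.sin (θ * r) * fderiv ℝ ψ (q (r, y)) (P x) -
        θ * Real.cos (θ * r) * fderiv ℝ ψ (q (r, y)) (P y)) =
      ψ (P x) - ψ (P (Real.cos θ • x + Real.sin θ • y)) := by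
    intro y
    have hder : ∀ r : ℝ, HasDerivAt (fun r => -ψ (q (r, y)))
        (θ * Real.sin (θ * r) * fderiv ℝ ψ (q (r, y)) (P x) -
          θ * Real.cos (θ * r) * fderiv ℝ ψ (q (r, y)) (P y)) r := by
      intro r
      have h0 : HasDerivAt (fun r : ℝ => θ * r) θ r := by
        simpa using (hasDerivAt_id r).const_mul θ
      have h1 : HasDerivAt (fun r => q (r, y))
          ((-Real.sin (θ * r) * θ) • P x + (Real.cos (θ * r) * θ) • P y) r :=
        (h0.cos.smul_const (P x)).add (h0.sin.smul_const (P y))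
      have h2 := ((hψd (q (r, y))).hasFDerivAt.comp_hasDerivAt r h1).neg
      refine h2.congr_deriv ?_
      simp only [map_add, map_smul, smul_eq_mul]
      ring
    have hqc : Continuous fun r : ℝ => q (r, y) := by
      simp only [q]; fun_prop
    have hfc := hψ.fderiv.1.continuous.comp hqc
    have hcont : Continuous fun r : ℝ => θ * Real.sin (θ * r) * fderiv ℝ ψ (q (r, y)) (P x) -
          θ * Real.cos (θ * r) * fderiv ℝ ψ (q (r, y)) (P y) := by
      have h1 : Continuous fun r : ℝ => fderiv ℝ ψ (q (r, y)) (P x) :=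
        hfc.clm_apply continuous_const
      have h2 : Continuous fun r : ℝ => fderiv ℝ ψ (q (r, y)) (P y) :=
        hfc.clm_apply continuous_const
      fun_prop
    rw [← intervalIntegral.integral_of_le zero_le_one,
      intervalIntegral.integral_eq_sub_of_hasDerivAt (fun r _ => hder r)
        (hcont.intervalIntegrable _ _)]
    simp [q]
    ring
  have hψP : Integrable (fun y => ψ (P (Real.cos θ • x + Real.sin θ • y))) γ := by
    have hcont : Continuous fun y => ψ (P (Real.cos θ • x + Real.sin θ • y)) :=
      hψ.1.continuous.comp (P.continuous.comp (by fun_prop))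
    exact Integrable.of_bound hcont.measurable.aestronglyMeasurable M (.of_forall fun y => hM _)
  have hID : Integrable (fun o : ℝ × X => θ * Real.sin (θ * o.1) * fderiv ℝ ψ (q o) (P x) -
      θ * Real.cos (θ * o.1) * fderiv ℝ ψ (q o) (P o.2)) (unifProd γ) := hIB.sub hIA
  rw [Finset.sum_sub_distrib, hA, hB, ← integral_sub hIB hIA, unifProd,
    integral_prod_symm _ hID]
  simp only [hFTC]
  rw [integral_sub (integrable_const _) hψP]
  simp [mehler]

end RotationDivergence

/-! ### The L^q bound for the field -/

section FieldNorm

lemma eLpNorm_id_gaussianReal {p : ℝ≥0∞} (hp : p ≠ 0) (hp_top : p ≠ ⊤) :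
    eLpNorm id p (gaussianReal 0 1) = ENNReal.ofReal (gaussMoment p.toReal) := by
  rw [MemLp.eLpNorm_eq_integral_rpow_norm hp hp_top (memLp_id_gaussianReal' p hp_top),
    integral_gaussianReal_eq_integral_smul one_ne_zero, gaussMoment, ← integral_const_mul,
    one_div]
  congr 2
  refine integral_congr_ae (.of_forall fun s => ?_)
  simp only [gaussianPDFReal, smul_eq_mul, id, Real.norm_eq_abs, NNReal.coe_one, mul_one, sub_zero]
  ring

lemma gaussianReal_zero_eq_map (v : ℝ≥0) :
    gaussianReal 0 v = (gaussianReal 0 1).map (fun x => √(v : ℝ) * x) := by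
  rw [gaussianReal_map_const_mul]
  congr 1
  · simp
  · ext; simp

/-- A centered Gaussian of variance v ≤ 1 is a standard one scaled by √v ≤ 1. -/
lemma eLpNorm_id_gaussianReal_le {v : ℝ≥0} (hv : v ≤ 1) (p : ℝ≥0∞) :
    eLpNorm id p (gaussianReal 0 v) ≤ eLpNorm id p (gaussianReal 0 1) := by
  rw [gaussianReal_zero_eq_map, eLpNorm_map_measure aestronglyMeasurable_id (by fun_prop)]
  refine eLpNorm_mono fun x => ?_
  simp only [Function.id_comp, norm_mul, id]
  refine mul_le_of_le_one_left (norm_nonneg x) ?_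
  rw [Real.norm_eq_abs, abs_of_nonneg (Real.sqrt_nonneg _), Real.sqrt_le_one]
  exact_mod_cast hv

variable {X : Type*} [AddCommGroup X] [Module ℝ X] [TopologicalSpace X]
  [MeasurableSpace X] [BorelSpace X]

lemma measurable_rot {n : ℕ} (P : X →L[ℝ] (Fin n → ℝ)) (θ : ℝ) :
    Measurable (fun z : X × ℝ × X =>
      Real.cos (θ * z.2.1) • P z.1 + Real.sin (θ * z.2.1) • P z.2.2) := by
  have hPm : Measurable P := P.continuous.measurable
  fun_prop

variable {γ : Measure X} [IsGaussian γ] (hc : ∀ l : X →L[ℝ] ℝ, ∫ x, l x ∂γ = 0)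
include hc

lemma eLpNorm_functional_le {m : X →L[ℝ] ℝ} (hm : ∫ x, (m x) ^ 2 ∂γ ≤ 1) {p : ℝ≥0∞}
    (hp : p ≠ 0) (hp_top : p ≠ ⊤) :
    eLpNorm m p γ ≤ ENNReal.ofReal (gaussMoment p.toReal) := by
  have hmm : Measurable m := m.continuous.measurable
  have hv : (covar γ m m).toNNReal ≤ 1 := by
    rw [covar_self_eq]
    exact Real.toNNReal_le_one.2 hm
  have h1 : eLpNorm id p (γ.map m) = eLpNorm m p γ := by
    rw [eLpNorm_map_measure aestronglyMeasurable_id hmm.aemeasurable, Function.id_comp]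
  rw [← h1, map_functional hc, ← eLpNorm_id_gaussianReal hp hp_top]
  exact eLpNorm_id_gaussianReal_le hv p

/-- A rotation by a random angle preserves the law of finitely many functionals. -/
lemma map_rot {n : ℕ} (l : Fin n → X →L[ℝ] ℝ) (θ : ℝ) :
    (γ.prod (unifProd γ)).map (fun z : X × ℝ × X =>
      Real.cos (θ * z.2.1) • ContinuousLinearMap.pi l z.1 +
        Real.sin (θ * z.2.1) • ContinuousLinearMap.pi l z.2.2) =
      γ.map (ContinuousLinearMap.pi l) := by
  set P : X →L[ℝ] (Fin n → ℝ) := ContinuousLinearMap.pi l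
  have hPm : Measurable P := P.continuous.measurable
  refine map_eq_map_of_charFun (by fun_prop) hPm fun t a => ?_
  set L : X →L[ℝ] ℝ := ∑ i ∈ t, a i • l i
  have hL : ∀ x, ∑ i ∈ t, a i * P x i = L x := fun x => by simp [P, L, sum_apply]
  have hLm : Measurable L := L.continuous.measurable
  have hL' : ∀ (c s : ℝ) (x y : X), ∑ i ∈ t, a i * (c • P x + s • P y) i = c * L x + s * L y := by
    intro c s x y
    rw [← hL, ← hL, Finset.mul_sum, Finset.mul_sum, ← Finset.sum_add_distrib]
    refine Finset.sum_congr rfl fun i _ => ?_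
    simp only [Pi.add_apply, Pi.smul_apply, smul_eq_mul]
    ring
  simp only [hL, hL']
  have hb : ∀ r : ℝ, ‖Complex.exp ((r : ℂ) * Complex.I)‖ ≤ 1 := fun r =>
    (Complex.norm_exp_ofReal_mul_I r).le
  have hI : Integrable (fun z : X × ℝ × X => Complex.exp
      (((Real.cos (θ * z.2.1) * L z.1 + Real.sin (θ * z.2.1) * L z.2.2 : ℝ) : ℂ) * Complex.I))
      (γ.prod (unifProd γ)) :=
    Integrable.of_bound (Measurable.aestronglyMeasurable (by fun_prop)) 1
      (.of_forall fun z => hb _)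
  have hI2 : ∀ r x, ∫ y, Complex.exp (((Real.cos r * L x + Real.sin r * L y : ℝ) : ℂ)
      * Complex.I) ∂γ = Complex.exp (((Real.cos r * L x : ℝ) : ℂ) * Complex.I) *
        Complex.exp (-((Real.sin r ^ 2 * covar γ L L : ℝ) : ℂ) / 2) := by
    intro r x
    have h := integral_cexp_functional_mul_I hc (Real.sin r • L)
    simp only [FunLike.coe_smul, Pi.smul_apply, covar_smul_left, covar_smul_right,
      smul_eq_mul] at h
    have e : ∀ y, Complex.exp (((Real.cos r * L x + Real.sin r * L y : ℝ) : ℂ) * Complex.I) =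
        Complex.exp (((Real.cos r * L x : ℝ) : ℂ) * Complex.I) *
          Complex.exp (((Real.sin r * L y : ℝ) : ℂ) * Complex.I) := by
      intro y
      rw [← Complex.exp_add]; congr 1; push_cast; ring
    simp only [e]
    rw [integral_const_mul, h]
    congr 3
    push_cast; ring
  have hI3 : ∀ r, ∫ x, Complex.exp (((Real.cos r * L x : ℝ) : ℂ) * Complex.I) *
        Complex.exp (-((Real.sin r ^ 2 * covar γ L L : ℝ) : ℂ) / 2) ∂γ =
      ∫ x, Complex.exp ((L x : ℂ) * Complex.I) ∂γ := by
    intro r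
    have h := integral_cexp_functional_mul_I hc (Real.cos r • L)
    simp only [FunLike.coe_smul, Pi.smul_apply, covar_smul_left, covar_smul_right,
      smul_eq_mul] at h
    rw [integral_mul_const, h, integral_cexp_functional_mul_I hc, ← Complex.exp_add]
    congr 1
    norm_cast
    linear_combination (-covar γ L L / 2) * Real.sin_sq_add_cos_sq r
  have hI4 : ∀ x, ∫ o : ℝ × X, Complex.exp (((Real.cos (θ * o.1) * L x +
      Real.sin (θ * o.1) * L o.2 : ℝ) : ℂ) * Complex.I) ∂(unifProd γ) =
      ∫ r in Set.Ioc (0 : ℝ) 1, Complex.exp (((Real.cos (θ * r) * L x : ℝ) : ℂ) * Complex.I) *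
        Complex.exp (-((Real.sin (θ * r) ^ 2 * covar γ L L : ℝ) : ℂ) / 2) := by
    intro x
    rw [unifProd, integral_prod]
    · simp only [hI2]
    · exact Integrable.of_bound (Measurable.aestronglyMeasurable (by fun_prop)) 1
        (.of_forall fun z => hb _)
  rw [integral_prod _ hI]
  simp only [hI4]
  -- With y integrated out, exchanging x and the angle allows integration in x at a fixed angle,
  -- where cos² + sin² = 1 restores the variance.
  rw [integral_integral_swap]
  · simp only [hI3]
    simp
  · refine Integrable.of_bound (Measurable.aestronglyMeasurable (by fun_prop)) 1
      (.of_forall fun z => ?_)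
    simp only [Function.uncurry, norm_mul]
    refine mul_le_one₀ (hb _) (norm_nonneg _) ?_
    rw [Complex.norm_exp, Real.exp_le_one_iff]
    have e : (-((Real.sin (θ * z.2) ^ 2 * covar γ L L : ℝ) : ℂ) / 2) =
        ((-(Real.sin (θ * z.2) ^ 2 * covar γ L L) / 2 : ℝ) : ℂ) := by push_cast; ring
    rw [e, Complex.ofReal_re]
    have := mul_nonneg (sq_nonneg (Real.sin (θ * z.2))) (covar_self_nonneg γ L)
    linarith

variable [IsTopologicalAddGroup X] [ContinuousSMul ℝ X] [LocallyConvexSpace ℝ X] [T2Space X]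
  [γ.InnerRegular]

/-- Pairing the field with a functional m of variance at most 1 gives, after integration by parts,
-θ ∫ ψ m. Hölder's inequality separates ψ from m, and the L^p norm of m is at most C(p). -/
lemma cmNorm_sum_rotGrad_le {n : ℕ} {l : Fin n → X →L[ℝ] ℝ} {h : Fin n → X}
    (hh : ∀ i, ∀ m : X →L[ℝ] ℝ, m (h i) = covar γ (l i) m) {ψ : (Fin n → ℝ) → ℝ}
    (hψ : IsBddSmooth ψ) (θ : ℝ) {p : ℝ≥0∞} (hp : 1 ≤ p) (hp_top : p ≠ ⊤) (x : X) :
    cmNorm γ (∑ i, (-rotGrad γ (ContinuousLinearMap.pi l) ψ θ (ContinuousLinearMap.pi l x)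
        (Pi.single i 1)) • h i) ≤
      ‖θ‖ₑ * ENNReal.ofReal (gaussMoment p.toReal) * eLpNorm (fun o : ℝ × X =>
        ψ (Real.cos (θ * o.1) • ContinuousLinearMap.pi l x +
          Real.sin (θ * o.1) • ContinuousLinearMap.pi l o.2)) p.conjExponent (unifProd γ) := by
  set P : X →L[ℝ] (Fin n → ℝ) := ContinuousLinearMap.pi l
  refine iSup_le fun m => iSup_le fun hm => ?_
  obtain ⟨k, hk⟩ := exists_covar_eq_apply hc m
  set q : ℝ × X → Fin n → ℝ := fun o => Real.cos (θ * o.1) • P x + Real.sin (θ * o.1) • P o.2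
  have hqm : Measurable q := by
    have hPm : Measurable P := P.continuous.measurable
    simp only [q]
    fun_prop
  -- Symmetry of the covariance: l j (k) = covar γ m (l j) = m (h j). Thus applying m to the field
  -- amounts to evaluating the averaged gradient at P k.
  have hPk : P k = ∑ i, m (h i) • (Pi.single i (1 : ℝ) : Fin n → ℝ) := by
    ext j
    simp [P, Finset.sum_apply, Pi.single_apply, hh, hk, covar_comm γ m]
  have e : m (∑ i, (-rotGrad γ P ψ θ (P x) (Pi.single i 1)) • h i) =
      -(θ * ∫ o, ψ (q o) * m o.2 ∂(unifProd γ)) := by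
    rw [← rotGrad_apply_eq hc P hψ θ hk (P x), hPk]
    simp only [map_sum, map_smul, smul_eq_mul, neg_mul, Finset.sum_neg_distrib]
    congr 1
    exact Finset.sum_congr rfl fun i _ => mul_comm _ _
  have hmm : Measurable m := m.continuous.measurable
  have := ENNReal.HolderConjugate.conjExponent hp
  rw [e]
  calc ENNReal.ofReal (-(θ * ∫ o, ψ (q o) * m o.2 ∂(unifProd γ)))
      ≤ ‖-(θ * ∫ o, ψ (q o) * m o.2 ∂(unifProd γ))‖ₑ := by
        rw [Real.enorm_eq_ofReal_abs]; exact ENNReal.ofReal_le_ofReal (le_abs_self _)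
    _ = ‖θ‖ₑ * ‖∫ o, ψ (q o) * m o.2 ∂(unifProd γ)‖ₑ := by rw [enorm_neg, enorm_mul]
    _ ≤ ‖θ‖ₑ * eLpNorm (fun o : ℝ × X => m o.2 • ψ (q o)) 1 (unifProd γ) := by
        rw [eLpNorm_one_eq_lintegral_enorm]
        gcongr
        refine (enorm_integral_le_lintegral_enorm _).trans_eq ?_
        simp only [smul_eq_mul, mul_comm]
    _ ≤ ‖θ‖ₑ * (eLpNorm (fun o : ℝ × X => m o.2) p (unifProd γ) *
          eLpNorm (fun o => ψ (q o)) p.conjExponent (unifProd γ)) := by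
        gcongr
        exact eLpNorm_smul_le_mul_eLpNorm (p := p) (q := p.conjExponent) (r := 1)
          (f := fun o => ψ (q o)) (φ := fun o : ℝ × X => m o.2)
          (hψ.1.continuous.measurable.comp hqm).aestronglyMeasurable
          (hmm.comp measurable_snd).aestronglyMeasurable
    _ ≤ ‖θ‖ₑ * (ENNReal.ofReal (gaussMoment p.toReal) *
          eLpNorm (fun o => ψ (q o)) p.conjExponent (unifProd γ)) := by
        gcongr
        have h1 : eLpNorm (m ∘ Prod.snd) p (unifProd γ) = eLpNorm m p γ :=
          eLpNorm_comp_measurePreserving hmm.aestronglyMeasurable measurePreserving_snd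
        exact h1.trans_le (eLpNorm_functional_le hc hm (zero_lt_one.trans_le hp).ne' hp_top)
    _ = _ := by rw [mul_assoc]

/-- Taking the L^q norm in x of the pointwise bound gives a norm over (x, σ, y); there the rotated
argument has the law of P under γ, so no constant is lost. -/
theorem eLpNorm_cmNorm_sum_rotGrad_le {n : ℕ} {l : Fin n → X →L[ℝ] ℝ} {h : Fin n → X}
    (hh : ∀ i, ∀ m : X →L[ℝ] ℝ, m (h i) = covar γ (l i) m) {ψ : (Fin n → ℝ) → ℝ}
    (hψ : IsBddSmooth ψ) (θ : ℝ) {p : ℝ≥0∞} (hp : 1 ≤ p) (hp_top : p ≠ ⊤) :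
    eLpNorm (fun x => cmNorm γ (∑ i, (-rotGrad γ (ContinuousLinearMap.pi l) ψ θ
        (ContinuousLinearMap.pi l x) (Pi.single i 1)) • h i)) p.conjExponent γ ≤
      ‖θ‖ₑ * ENNReal.ofReal (gaussMoment p.toReal) *
        eLpNorm (fun x => ψ (ContinuousLinearMap.pi l x)) p.conjExponent γ := by
  set P : X →L[ℝ] (Fin n → ℝ) := ContinuousLinearMap.pi l
  set K := ‖θ‖ₑ * ENNReal.ofReal (gaussMoment p.toReal)
  have hK : K ≠ ⊤ := ENNReal.mul_ne_top enorm_ne_top ENNReal.ofReal_ne_top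
  have hq0 : p.conjExponent ≠ 0 := by
    have := ENNReal.HolderConjugate.conjExponent hp
    exact ENNReal.HolderConjugate.ne_zero _ p
  set G : X × ℝ × X → ℝ := fun z =>
    ψ (Real.cos (θ * z.2.1) • P z.1 + Real.sin (θ * z.2.1) • P z.2.2)
  have hψm : Measurable ψ := hψ.1.continuous.measurable
  have hG : Measurable G := hψm.comp (measurable_rot P θ)
  calc _ ≤ eLpNorm (fun x => K * eLpNorm (fun o => G (x, o)) p.conjExponent (unifProd γ))
        p.conjExponent γ := by
        refine eLpNorm_mono_enorm fun x => ?_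
        simp only [enorm_eq_self]
        exact cmNorm_sum_rotGrad_le hc hh hψ θ hp hp_top x
    _ ≤ K * eLpNorm (fun x => eLpNorm (fun o => G (x, o)) p.conjExponent (unifProd γ))
        p.conjExponent γ := by
        clear_value K
        lift K to ℝ≥0 using hK
        exact eLpNorm_le_mul_eLpNorm_of_ae_le_mul' (.of_forall fun x => le_rfl) _
    _ ≤ K * eLpNorm G p.conjExponent (γ.prod (unifProd γ)) := by
        gcongr
        exact eLpNorm_eLpNorm_le hG.aestronglyMeasurable _ hq0
    _ = _ := by
        have h1 := eLpNorm_map_measure (p := p.conjExponent) (μ := γ.prod (unifProd γ)) (g := ψ)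
          hψm.aestronglyMeasurable (measurable_rot P θ).aemeasurable
        rw [map_rot hc l θ, eLpNorm_map_measure hψm.aestronglyMeasurable
          P.continuous.measurable.aemeasurable] at h1
        congr 1
        exact h1.symm

end FieldNorm

/-! ### From compactly supported to bounded coefficients -/

section Cutoff

variable {X : Type*} [AddCommGroup X] [Module ℝ X] [TopologicalSpace X]
  [MeasurableSpace X]

lemma cmNorm_smul_le (γ : Measure X) {r : ℝ} (h0 : 0 ≤ r) (h1 : r ≤ 1) (v : X) :
    cmNorm γ (r • v) ≤ cmNorm γ v := by
  refine iSup₂_mono fun m _ => ?_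
  rw [map_smul, smul_eq_mul, ENNReal.ofReal_mul h0]
  exact mul_le_of_le_one_left' (ENNReal.ofReal_le_one.2 h1)

/-- Smooth cutoff functions with uniformly small derivative. -/
lemma exists_cutoff (n : ℕ) : ∃ (χ : ℕ → (Fin n → ℝ) → ℝ) (M : ℝ), 0 ≤ M ∧
    (∀ k, IsC0Infty (χ k)) ∧ (∀ k z, χ k z ∈ Set.Icc (0 : ℝ) 1) ∧
    (∀ z, ∀ᶠ k in Filter.atTop, χ k z = 1) ∧
    ∀ k z, ‖fderiv ℝ (χ k) z‖ ≤ M * (1 / ((k : ℝ) + 1)) := by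
  obtain ⟨χ, hχ, h1, -, hI⟩ := exists_isC0Infty_zero_one (isCompact_closedBall (0 : Fin n → ℝ) 1)
    (isCompact_empty) (Set.disjoint_empty _)
  have hb : IsBddSmooth χ := hχ.isCbInfty
  obtain ⟨M, hM0, hM⟩ := hb.fderiv.bounded
  have hr : ∀ k : ℕ, 0 < 1 / ((k : ℝ) + 1) := fun k => by positivity
  refine ⟨fun k z => χ ((1 / ((k : ℝ) + 1)) • z), M, hM0, fun k => ⟨?_, ?_⟩, fun k z => hI _,
    fun z => ?_, fun k z => ?_⟩
  · exact hχ.1.comp (contDiff_const_smul _)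
  · exact hχ.2.comp_homeomorph (Homeomorph.smulOfNeZero _ (hr k).ne')
  · obtain ⟨N, hN⟩ := exists_nat_ge ‖z‖
    filter_upwards [Filter.eventually_ge_atTop N] with k hk
    refine h1 ?_
    have hk' : (N : ℝ) ≤ k := by exact_mod_cast hk
    rw [mem_closedBall_zero_iff, norm_smul, Real.norm_eq_abs, abs_of_pos (hr k), one_div,
      inv_mul_le_iff₀ (by positivity)]
    linarith
  · have hd : HasFDerivAt (fun z => χ ((1 / ((k : ℝ) + 1)) • z))
        ((1 / ((k : ℝ) + 1)) • fderiv ℝ χ ((1 / ((k : ℝ) + 1)) • z)) z := by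
      have h2 := ((hχ.1.differentiable (by simp) ((1 / ((k : ℝ) + 1)) • z)).hasFDerivAt).comp z
        ((hasFDerivAt_id z).const_smul (1 / ((k : ℝ) + 1)))
      refine h2.congr_fderiv ?_
      ext u
      simp
    rw [hd.fderiv, norm_smul, Real.norm_eq_abs, abs_of_pos (hr k), mul_comm]
    gcongr
    exact hM _

variable [BorelSpace X] {γ : Measure X} [IsGaussian γ]
  (hc : ∀ l : X →L[ℝ] ℝ, ∫ x, l x ∂γ = 0)
  [IsTopologicalAddGroup X] [ContinuousSMul ℝ X] [LocallyConvexSpace ℝ X] [T2Space X]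
  [γ.InnerRegular]
include hc

/-- The Besov inequality extends from compactly supported to bounded smooth cylindrical fields with
bounded divergence. -/
theorem IsBesovBound.of_bounded {p : ℝ≥0∞} {α : ℝ} (hα : 0 ≤ α) (hα1 : α ≤ 1) {f : X → ℝ}
    (hf : Integrable f γ) {C : ℝ≥0} (hC : IsBesovBound γ p α f C) (hq : 1 ≤ p.conjExponent)
    {n : ℕ} {l : Fin n → X →L[ℝ] ℝ} {h : Fin n → X}
    (hh : ∀ i, ∀ m : X →L[ℝ] ℝ, m (h i) = covar γ (l i) m) {Ψ : Fin n → (Fin n → ℝ) → ℝ}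
    (hΨ : ∀ i, ContDiff ℝ ∞ (Ψ i)) {B : ℝ} (hB : ∀ i z, |Ψ i z| ≤ B) {D : X → ℝ}
    (hD : ∀ x, D x = ∑ i, (fderiv ℝ (Ψ i) (ContinuousLinearMap.pi l x)
        (ContinuousLinearMap.pi l (h i)) - Ψ i (ContinuousLinearMap.pi l x) * l i x))
    (hDm : AEStronglyMeasurable D γ) {M : ℝ} (hM : ∀ x, |D x| ≤ M) {N : ℝ≥0∞} (hN : N ≠ ⊤)
    (hΦ : eLpNorm (fun x => cmNorm γ (∑ i, Ψ i (ContinuousLinearMap.pi l x) • h i))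
      p.conjExponent γ ≤ N) :
    ENNReal.ofReal (∫ x, f x * D x ∂γ) ≤
      C * N ^ α * eLpNorm D p.conjExponent γ ^ (1 - α) := by
  set P : X →L[ℝ] (Fin n → ℝ) := ContinuousLinearMap.pi l
  obtain ⟨χ, A, hA, hχ, hχI, hχ1, hχ'⟩ := exists_cutoff n
  set r : ℕ → ℝ := fun k => 1 / ((k : ℝ) + 1) with hr
  have hr0 : ∀ k, 0 ≤ r k := fun k => by positivity
  have hr1 : ∀ k, r k ≤ 1 := fun k => by
    rw [hr]
    simp only
    rw [div_le_one (by positivity)]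
    linarith [(Nat.cast_nonneg k : (0 : ℝ) ≤ k)]
  have hrt : Filter.Tendsto r Filter.atTop (nhds 0) := tendsto_one_div_add_atTop_nhds_zero_nat
  set Θ : ℕ → Fin n → (Fin n → ℝ) → ℝ := fun k i z => χ k z * Ψ i z
  have hΘ : ∀ k i, IsC0Infty (Θ k i) := fun k i =>
    ⟨(hχ k).1.mul (hΨ i), (hχ k).2.mul_right⟩
  set E : ℕ → X → ℝ := fun k x => ∑ i, Ψ i (P x) * fderiv ℝ (χ k) (P x) (P (h i))
  set Dk : ℕ → X → ℝ := fun k x => ∑ i, (fderiv ℝ (Θ k i) (P x) (P (h i)) - Θ k i (P x) * l i x)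
  -- The product rule: cutting off the field multiplies the divergence by χ k and adds an error of
  -- order 1/(k+1), uniform in x.
  have hDk : ∀ k x, Dk k x = χ k (P x) * D x + E k x := by
    intro k x
    simp only [Dk, E, hD, Finset.mul_sum, ← Finset.sum_add_distrib]
    refine Finset.sum_congr rfl fun i _ => ?_
    have e := fderiv_fun_mul ((hχ k).1.differentiable (by simp) (P x))
      ((hΨ i).differentiable (by simp) (P x))
    simp only [Θ, e, add_apply, FunLike.coe_smul, Pi.smul_apply, smul_eq_mul]
    ring
  set A' : ℝ := ∑ i, |B| * (A * ‖P (h i)‖)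
  have hA' : 0 ≤ A' := Finset.sum_nonneg fun i _ => by positivity
  have hE : ∀ k x, |E k x| ≤ A' * r k := by
    intro k x
    simp only [A', Finset.sum_mul]
    refine (Finset.abs_sum_le_sum_abs _ _).trans (Finset.sum_le_sum fun i _ => ?_)
    rw [abs_mul, mul_assoc]
    refine mul_le_mul ((hB i _).trans (le_abs_self B)) ?_ (abs_nonneg _) (abs_nonneg _)
    refine ((fderiv ℝ (χ k) (P x)).le_opNorm _).trans ?_
    calc _ ≤ A * r k * ‖P (h i)‖ := by gcongr; exact hχ' k _
      _ = _ := by ring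
  have hχD : ∀ k x, |χ k (P x) * D x| ≤ |D x| := fun k x => by
    rw [abs_mul, abs_of_nonneg (hχI k _).1]
    exact mul_le_of_le_one_left (abs_nonneg _) (hχI k _).2
  have hDkD : ∀ k x, |Dk k x| ≤ |D x| + A' * r k := fun k x => by
    rw [hDk]
    exact (abs_add_le _ _).trans (add_le_add (hχD k x) (hE k x))
  have hDkM : ∀ k x, |Dk k x| ≤ M + A' := fun k x =>
    (hDkD k x).trans (add_le_add (hM x) (mul_le_of_le_one_right hA' (hr1 k)))
  have hdiv : ∀ k, IsGaussDiv γ (fun x => ∑ i, Θ k i (P x) • h i) (Dk k) := fun k =>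
    isGaussDiv_sum hc hh (hΘ k)
  have hDkm : ∀ k, AEStronglyMeasurable (Dk k) γ := fun k => (hdiv k).1.1
  have hnorm : ∀ k, eLpNorm (fun x => cmNorm γ (∑ i, Θ k i (P x) • h i)) p.conjExponent γ ≤ N := by
    refine fun k => (eLpNorm_mono_enorm fun x => ?_).trans hΦ
    simp only [enorm_eq_self, Θ, mul_smul, ← Finset.smul_sum]
    exact cmNorm_smul_le γ (hχI k _).1 (hχI k _).2 _
  -- Only an upper bound for the norms is needed; the uniform error makes it valid for q = ∞, where
  -- norm convergence of Dk could fail.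
  have hnormD : ∀ k, eLpNorm (Dk k) p.conjExponent γ ≤
      eLpNorm D p.conjExponent γ + ENNReal.ofReal (A' * r k) := by
    intro k
    have hA'r : 0 ≤ A' * r k := mul_nonneg hA' (hr0 k)
    calc eLpNorm (Dk k) p.conjExponent γ
        ≤ eLpNorm ((fun x => |D x|) + fun _ => A' * r k) p.conjExponent γ :=
          eLpNorm_mono_real fun x => hDkD k x
      _ ≤ eLpNorm (fun x => |D x|) p.conjExponent γ +
            eLpNorm (fun _ : X => A' * r k) p.conjExponent γ :=
          eLpNorm_add_le hDm.norm aestronglyMeasurable_const hq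
      _ = _ := by
          congr 1
          · exact eLpNorm_norm D
          · rw [eLpNorm_const _ (zero_lt_one.trans_le hq).ne' (IsProbabilityMeasure.ne_zero γ),
              measure_univ, ENNReal.one_rpow, mul_one, Real.enorm_eq_ofReal hA'r]
  have hineq : ∀ k, ENNReal.ofReal (∫ x, f x * Dk k x ∂γ) ≤
      C * N ^ α * (eLpNorm D p.conjExponent γ + ENNReal.ofReal (A' * r k)) ^ (1 - α) := by
    intro k
    have hfield : IsCylField γ fun x => ∑ i, Θ k i (P x) • h i :=
      ⟨n, Θ k, l, h, hΘ k, fun i => mem_cameronMartin hc (hh i), fun x => rfl⟩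
    refine (hC _ _ hfield (hdiv k) (MemLp.of_bound (hDkm k) (M + A')
      (.of_forall fun x => hDkM k x))).trans ?_
    have := sub_nonneg.2 hα1
    gcongr
    · exact hnorm k
    · exact hnormD k
  have hlim1 : Filter.Tendsto (fun k => ENNReal.ofReal (∫ x, f x * Dk k x ∂γ)) Filter.atTop
      (nhds (ENNReal.ofReal (∫ x, f x * D x ∂γ))) := by
    refine ENNReal.tendsto_ofReal (tendsto_integral_mul_of_bound hf hDkm hDkM
      (.of_forall fun x => ?_))
    have h1 : Filter.Tendsto (fun k => χ k (P x) * D x) Filter.atTop (nhds (D x)) := by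
      refine tendsto_const_nhds.congr' ?_
      filter_upwards [hχ1 (P x)] with k hk
      rw [hk, one_mul]
    have h2 : Filter.Tendsto (fun k => E k x) Filter.atTop (nhds 0) := by
      refine squeeze_zero_norm (fun k => hE k x) ?_
      simpa using hrt.const_mul A'
    simpa only [hDk, add_zero] using h1.add h2
  have hlim2 : Filter.Tendsto (fun k => C * N ^ α *
      (eLpNorm D p.conjExponent γ + ENNReal.ofReal (A' * r k)) ^ (1 - α)) Filter.atTop
      (nhds (C * N ^ α * eLpNorm D p.conjExponent γ ^ (1 - α))) := by
    refine ENNReal.Tendsto.const_mul ?_ (Or.inr (ENNReal.mul_ne_top ENNReal.coe_ne_top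
      (ENNReal.rpow_ne_top_of_nonneg hα hN)))
    refine (ENNReal.continuous_rpow_const.tendsto _).comp ?_
    have h1 : Filter.Tendsto (fun k => ENNReal.ofReal (A' * r k)) Filter.atTop (nhds 0) := by
      simpa using ENNReal.tendsto_ofReal (hrt.const_mul A')
    simpa using (tendsto_const_nhds (x := eLpNorm D p.conjExponent γ)).add h1
  exact le_of_tendsto_of_tendsto' hlim1 hlim2 hineq

end Cutoff

/-! ### The constant c_t as an angle -/

section Angle

lemma arccos_exp_neg_eq_ouConst {t : ℝ} (ht : 0 ≤ t) :
    Real.arccos (Real.exp (-t)) = ouConst t := by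
  have hexp : ∀ s : ℝ, Real.exp (-2 * s) = Real.exp (-s) ^ 2 := fun s => by
    rw [← Real.exp_nat_mul]; congr 1; push_cast; ring
  have hder : ∀ s ∈ Set.Ioo 0 t, HasDerivAt (fun s => Real.arccos (Real.exp (-s)))
      (Real.exp (-s) / √(1 - Real.exp (-2 * s))) s := by
    intro s hs
    have h1 : Real.exp (-s) < 1 := by
      rw [Real.exp_lt_one_iff]; linarith [hs.1]
    have h2 := (Real.hasDerivAt_arccos (by linarith [Real.exp_pos (-s)]) h1.ne).comp s
      ((hasDerivAt_neg s).exp)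
    refine h2.congr_deriv ?_
    rw [hexp]
    ring
  have hcont : ContinuousOn (fun s => Real.arccos (Real.exp (-s))) (Set.Icc 0 t) :=
    (Real.continuous_arccos.comp (by fun_prop)).continuousOn
  -- The integrand is singular at 0; it is integrable as the nonnegative derivative of a function
  -- continuous up to the endpoints.
  have hint := intervalIntegral.integrableOn_deriv_of_nonneg hcont hder fun s _ => by positivity
  rw [ouConst, intervalIntegral.integral_eq_sub_of_hasDerivAt_of_le ht hcont hder
    ((intervalIntegrable_iff_integrableOn_Ioc_of_le ht).2 hint)]
  simp

end Angle

/-! ### The Besov estimate by duality -/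

section Main

variable {X : Type*} [AddCommGroup X] [Module ℝ X] [TopologicalSpace X]
  [IsTopologicalAddGroup X] [ContinuousSMul ℝ X] [LocallyConvexSpace ℝ X] [T2Space X]
  [MeasurableSpace X] [BorelSpace X] {γ : Measure X} [IsGaussian γ] [γ.InnerRegular]
  (hc : ∀ l : X →L[ℝ] ℝ, ∫ x, l x ∂γ = 0)
include hc

/-- The Besov inequality for the averaged gradient field of a cylindrical function. -/
lemma IsBesovBound.ofReal_integral_sub_mehler_le {p : ℝ≥0∞} (hp : 1 ≤ p) (hp_top : p ≠ ⊤) {α : ℝ}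
    (hα : 0 ≤ α) (hα1 : α ≤ 1) {f : X → ℝ} (hf : Integrable f γ) {C : ℝ≥0}
    (hC : IsBesovBound γ p α f C) (θ : ℝ) {u : X → ℝ} (hu : IsCylFun u) :
    ENNReal.ofReal (∫ x, f x * (u x - mehler γ (Real.cos θ) (Real.sin θ) u x) ∂γ) ≤
      C * (‖θ‖ₑ * ENNReal.ofReal (gaussMoment p.toReal) * eLpNorm u p.conjExponent γ) ^ α *
        (2 * eLpNorm u p.conjExponent γ) ^ (1 - α) := by
  obtain ⟨n, ψ, l, hψ, hul⟩ := hu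
  obtain rfl : u = fun x => ψ (ContinuousLinearMap.pi l x) := funext hul
  choose h hh using fun i => exists_covar_eq_apply hc (l i)
  have hψ' : IsBddSmooth ψ := hψ
  set P : X →L[ℝ] (Fin n → ℝ) := ContinuousLinearMap.pi l with hP
  have := ENNReal.HolderConjugate.conjExponent hp
  have hq : 1 ≤ p.conjExponent := ENNReal.HolderConjugate.one_le _ p
  obtain ⟨M, hM0, hM⟩ := hψ'.bounded
  have hum : Measurable fun x => ψ (P x) := hψ.1.continuous.measurable.comp P.continuous.measurable
  have hup : MemLp (fun x => ψ (P x)) p.conjExponent γ :=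
    MemLp.of_bound hum.aestronglyMeasurable M (.of_forall fun x => hM _)
  obtain ⟨-, hmem, hmle⟩ := mehler_facts hc (Real.cos_sq_add_sin_sq θ) hq hup
  set u : X → ℝ := fun x => ψ (P x) with hu
  have hTM : ∀ x, |mehler γ (Real.cos θ) (Real.sin θ) u x| ≤ M := fun x =>
    (norm_integral_le_of_norm_le_const (.of_forall fun y => hM _)).trans (by simp)
  obtain ⟨B, hB0, hB⟩ := exists_norm_rotGrad_le (γ := γ) P hψ' θ
  have key := IsBesovBound.of_bounded hc hα hα1 hf hC hq hh
    (Ψ := fun i z => -rotGrad γ P ψ θ z (Pi.single i 1)) (B := B)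
    (D := fun x => u x - mehler γ (Real.cos θ) (Real.sin θ) u x) (M := M + M)
    (N := ‖θ‖ₑ * ENNReal.ofReal (gaussMoment p.toReal) * eLpNorm u p.conjExponent γ)
    (fun i => ((contDiff_rotGrad P hψ' θ).clm_apply contDiff_const).neg)
    (fun i z => by
      rw [abs_neg]
      refine ((rotGrad γ P ψ θ z).le_opNorm _).trans ?_
      rw [Pi.norm_single]
      simpa using hB z)
    (fun x => by
      rw [hu, ← sum_rotGrad_eq hc hh hψ' θ x]
      refine Finset.sum_congr rfl fun i _ => ?_
      have hd : DifferentiableAt ℝ (rotGrad γ P ψ θ) (P x) :=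
        (contDiff_rotGrad P hψ' θ).differentiable (by simp) _
      rw [fderiv_fun_neg, fderiv_clm_apply hd (differentiableAt_const _)]
      simp [hP]
      ring)
    (hup.1.sub hmem.1)
    (fun x => (abs_sub _ _).trans (add_le_add (hM _) (hTM x)))
    (ENNReal.mul_ne_top (ENNReal.mul_ne_top enorm_ne_top ENNReal.ofReal_ne_top) hup.2.ne)
    (eLpNorm_cmNorm_sum_rotGrad_le hc hh hψ' θ hp hp_top)
  refine key.trans ?_
  have h1α := sub_nonneg.2 hα1
  gcongr
  -- The factor 2 in the bound for the divergence comes from the triangle inequality and the L^q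
  -- contraction of the Mehler operator.
  refine (eLpNorm_sub_le hup.1 hmem.1 hq).trans ?_
  rw [two_mul]
  gcongr

/-- By symmetry the operator moves to the test function. The resulting bound is homogeneous of
degree α + (1 - α) = 1 in ‖u‖_q, as duality requires. -/
theorem IsBesovBound.eLpNorm_sub_mehler_le {p : ℝ≥0∞} (hp : 1 ≤ p) (hp_top : p ≠ ⊤) {α : ℝ}
    (hα : 0 ≤ α) (hα1 : α ≤ 1) {f : X → ℝ} (hf : MemLp f p γ) {C : ℝ≥0}
    (hC : IsBesovBound γ p α f C) {θ : ℝ} (hθ : 0 ≤ θ) :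
    eLpNorm (fun x => f x - mehler γ (Real.cos θ) (Real.sin θ) f x) p γ ≤
      ENNReal.ofReal (2 ^ (1 - α) * gaussMoment p.toReal ^ α * θ ^ α) * C := by
  have hcs := Real.cos_sq_add_sin_sq θ
  have h1α := sub_nonneg.2 hα1
  have hG : 0 ≤ gaussMoment p.toReal :=
    Real.rpow_nonneg (mul_nonneg (by positivity) (integral_nonneg fun s => by positivity)) _
  obtain ⟨-, hTp, -⟩ := mehler_facts hc hcs hp hf
  have hfi := hf.integrable hp
  have hTi := hTp.integrable hp
  refine eLpNorm_le_of_forall_isCylFun hp hp_top (hfi.sub hTi)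
    (ENNReal.mul_ne_top ENNReal.ofReal_ne_top ENNReal.coe_ne_top) fun u hu => ?_
  obtain ⟨M, hM⟩ := hu.bounded
  have hum := hu.continuous.measurable.aestronglyMeasurable (μ := γ)
  have hup : MemLp u 1 γ := MemLp.of_bound hum M (.of_forall fun x => hM _)
  obtain ⟨-, hTu, -⟩ := mehler_facts hc hcs le_rfl hup
  have hTM : ∀ x, ‖mehler γ (Real.cos θ) (Real.sin θ) u x‖ ≤ M := fun x =>
    (norm_integral_le_of_norm_le_const (.of_forall fun y => hM _)).trans (by simp)
  have e : ∫ x, (f x - mehler γ (Real.cos θ) (Real.sin θ) f x) * u x ∂γ =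
      ∫ x, f x * (u x - mehler γ (Real.cos θ) (Real.sin θ) u x) ∂γ := by
    simp only [sub_mul, mul_sub]
    rw [integral_sub (hfi.mul_bdd hum (.of_forall hM)) (hTi.mul_bdd hum (.of_forall hM)),
      integral_sub (hfi.mul_bdd hum (.of_forall hM)) (hfi.mul_bdd hTu.1 (.of_forall hTM)),
      integral_mehler_mul hc hcs hfi hu]
  simp only [Pi.sub_apply]
  rw [e]
  refine (hC.ofReal_integral_sub_mehler_le hc hp hp_top hα hα1 hfi θ hu).trans_eq ?_
  set U := eLpNorm u p.conjExponent γ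
  have hU : U ^ α * U ^ (1 - α) = U := by
    rw [← ENNReal.rpow_add_of_nonneg _ _ hα h1α, add_sub_cancel, ENNReal.rpow_one]
  rw [ENNReal.mul_rpow_of_nonneg _ _ hα, ENNReal.mul_rpow_of_nonneg _ _ hα,
    ENNReal.mul_rpow_of_nonneg _ _ h1α, Real.enorm_eq_ofReal hθ,
    ENNReal.ofReal_mul (by positivity), ENNReal.ofReal_mul (by positivity),
    ← ENNReal.ofReal_rpow_of_nonneg hG hα, ← ENNReal.ofReal_rpow_of_nonneg hθ hα,
    ← ENNReal.ofReal_rpow_of_nonneg zero_le_two h1α, ENNReal.ofReal_ofNat]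
  conv_rhs => rw [← hU]
  ring

end Main

end GaussBesov

theorem theorem3p1 {X : Type*} [AddCommGroup X] [Module ℝ X] [TopologicalSpace X]
    [IsTopologicalAddGroup X] [ContinuousSMul ℝ X] [LocallyConvexSpace ℝ X] [T2Space X]
    [MeasurableSpace X] [BorelSpace X]
    (γ : Measure X) [IsGaussian γ] [γ.InnerRegular]
    (hcentered : ∀ l : X →L[ℝ] ℝ, ∫ x, l x ∂γ = 0)
    (p : ℝ≥0∞) (hp : 1 ≤ p) (hp_top : p ≠ ⊤) (α : ℝ) (hα : 0 < α) (hα_one : α ≤ 1)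
    (f : X → ℝ) (hf : GaussBesov.MemBesov γ p α f) (t : ℝ) (ht : 0 ≤ t) :
    (∀ᵐ x ∂γ, Integrable
        (fun y => f (Real.exp (-t) • x + √(1 - Real.exp (-2 * t)) • y)) γ) ∧
      MemLp (GaussBesov.ornsteinUhlenbeck γ t f) p γ ∧
      eLpNorm (fun x => f x - GaussBesov.ornsteinUhlenbeck γ t f x) p γ ≤
        ENNReal.ofReal (2 ^ (1 - α) * GaussBesov.gaussMoment p.toReal ^ α * GaussBesov.ouConst t ^ α) *
          GaussBesov.besovV γ p α f := by
  have hexp : Real.exp (-2 * t) = Real.exp (-t) ^ 2 := by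
    rw [← Real.exp_nat_mul]; congr 1; push_cast; ring
  have h1 : Real.exp (-t) ≤ 1 := Real.exp_le_one_iff.2 (by linarith)
  have hcos : Real.cos (GaussBesov.ouConst t) = Real.exp (-t) := by
    rw [← GaussBesov.arccos_exp_neg_eq_ouConst ht,
      Real.cos_arccos (by linarith [Real.exp_pos (-t)]) h1]
  have hsin : Real.sin (GaussBesov.ouConst t) = √(1 - Real.exp (-2 * t)) := by
    rw [← GaussBesov.arccos_exp_neg_eq_ouConst ht, Real.sin_arccos, hexp]
  have hθ : 0 ≤ GaussBesov.ouConst t := by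
    rw [← GaussBesov.arccos_exp_neg_eq_ouConst ht]; exact Real.arccos_nonneg _
  have hOU : GaussBesov.ornsteinUhlenbeck γ t f = GaussBesov.mehler γ
      (Real.cos (GaussBesov.ouConst t)) (Real.sin (GaussBesov.ouConst t)) f := by
    rw [hcos, hsin]; rfl
  obtain ⟨hint, hmem, -⟩ := GaussBesov.mehler_facts hcentered
    (Real.cos_sq_add_sin_sq (GaussBesov.ouConst t)) hp hf.1
  refine ⟨by rwa [hcos, hsin] at hint, by rwa [hOU], ?_⟩
  rw [hOU]
  have key := fun C (hC : GaussBesov.IsBesovBound γ p α f C) =>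
    hC.eLpNorm_sub_mehler_le hcentered hp hp_top hα.le hα_one hf.1 hθ
  obtain ⟨C₀, hC₀⟩ := hf.2
  -- The infimum over C takes the value ∞ at inadmissible C, so the constant can be moved inside
  -- only if it is nonzero. If it is zero, as for t = 0, a single admissible C₀ already gives the
  -- bound 0.
  rcases eq_or_ne (ENNReal.ofReal (2 ^ (1 - α) * GaussBesov.gaussMoment p.toReal ^ α *
      GaussBesov.ouConst t ^ α)) 0 with h0 | h0
  · have := key C₀ hC₀
    rw [h0, zero_mul] at this ⊢
    exact this
  · rw [GaussBesov.besovV, ENNReal.mul_iInf_of_ne h0 ENNReal.ofReal_ne_top]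
    refine le_iInf fun C => ?_
    rw [ENNReal.mul_iInf_of_ne h0 ENNReal.ofReal_ne_top]
    exact le_iInf fun hC => key C hC
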